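/- **Conventions.** Fix a first-order language $\mathscr L$: a set $\mathscr L_q$ of quantifier symbols and sets $\mathscr L_n$ ($n\in\omega$) of $n$-ary connectives, $\mathscr L_\omega=\bigcup_n\mathscr L_n$, with designated $e\in\mathscr L_0$ and $\otimes\in\mathscr L_2$. *The 2-category $\mathbf{FA}$.* An object is a pair $(\mathcal C,P)$ of a category $\mathcal C$ with designated finite products and a contravariant functor $P$ from $\mathcal C$ to the category $\mathbf{Pos}$ of posets and monotone maps, such that: 1. each $P(c)$ is an $\mathscr L_\omega$-algebra and each $P(f)$ is a homomorphism of $\mathscr L_\omega$-algebras (the operations need be neither monotone nor subject to equations other than those in 4); 2. each $c$ has a designated element $Eq_c\in P(c\times c)$; 3. for $\Omega\in\mathscr L_q$ and objects $b,c$ there is a map (of sets) $\Omega_{b,c}\colon P(b\times c)\to P(b)$, natural in $b$; 4. each $(P(c),\otimes,e_c)$ is a monoid; 5. $\Omega_{b,1}\circ P(\pi_1^{b,1})=\mathrm{id}_{P(b)}$ and $\Omega_{b,c\times d}\circ P(a_{b,c,d})=\Omega_{b,c}\circ\Omega_{b\times c,d}$, where $a_{b,c,d}\colon b\times(c\times d)\to(b\times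 c)\times d$ is the canonical isomorphism; 6. $Eq_1=e_{1\times1}$, and for $c=c_1\times c_2$, $Eq_c=P(\langle\pi_1^{c_1,c_2}\pi_1^{c,c},\pi_1^{c_1,c_2}\pi_2^{c,c}\rangle)Eq_{c_1}\otimes P(\langle\pi_2^{c_1,c_2}\pi_1^{c,c},\pi_2^{c_1,c_2}\pi_2^{c,c}\rangle)Eq_{c_2}$. A morphism $F\colon(\mathcal C,P)\to(\mathcal D,Q)$ is a finite product preserving functor $F^o\colon\mathcal C\to\mathcal D$ together with a natural transformation $F^p\colon P\Rightarrow Q\circ F^o$ whose (monotone) components are homomorphisms of $\mathscr L_\omega$-algebras and satisfy $F^p_b\circ\Omega_{b,c}=\Omega_{F^ob,F^oc}\circ Q(a_{b,c}^{-1})\circ F^p_{b\times c}$ and $F^p_{c\times c}(Eq_c)=Q(a_{c,c})(Eq_{F^oc})$, where $a_{b,c}\colon F^o(b\times c)\to F^ob\times F^oc$ is the canonical isomorphism. A 2-cell $\eta\colon F\Rightarrow H$ is a natural transformation $\eta\colon F^o\Rightarrow H^o$ with $F^p_c=Q(\eta_c)\circ H^p_c$ for all $c$; it is a 2-isomorphism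 if $\eta$ is a natural isomorphism. Composition of morphisms is the evident one. A morphism $F\colon X\to Y$ is a *2-equivalence* if there is a morphism $K\colon Y\to X$ with $K\circ F$ and $F\circ K$ 2-isomorphic to the identities. *Syntax.* A signature $Sg$ has sorts, function symbols $f\colon\sigma_1,\dots,\sigma_n\to\tau$ and relation symbols $R\subseteq\sigma_1,\dots,\sigma_n$ ($n\ge0$). Terms-in-context $M:\tau\,[\Gamma]$ are built from variables and function symbols; formulas-in-context $\phi\,[\Gamma]$ are built from $R(M_1,\dots,M_n)$, $M_1=_\tau M_2$, $\Diamond(\phi_1,\dots,\phi_n)$ for $\Diamond\in\mathscr L_n$, and $\Omega_{x:\sigma}(\phi)$ for $\Omega\in\mathscr L_q$ (with $\phi\,[\Gamma,x:\sigma]$). Contexts, terms and formulas are taken up to renaming of variables. An assertion is an equation $M=N:\tau\,[\Gamma]$ or a sequent $\phi_1,\dots,\phi_n\vdash\psi\,[\Gamma]$ ($n\ge0$); an $Sg$-theory is a set of assertions. The logic $\mathcal L^m$ consists of equational logic, reflexivity $\phi\vdash\phi$, cut for single formulas, weakening of the context, substitution of provably equal terms (from $M=M':\sigma\,[\Delta]$,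 with the variables of $\Delta$ among those of $\Gamma,\Gamma'$, and $\Phi\vdash\psi\,[\Gamma,x:\sigma,\Gamma']$ infer $\Phi[M/x]\vdash\psi[M'/x]\,[\Gamma,\Gamma']$), the rules that all $\Omega_{x:\sigma}$ and $\Diamond$ respect $\dashv\vdash$, and the two-way rules identifying $\Phi,\alpha,\beta,\Psi\vdash\theta$ with $\Phi,\alpha\otimes\beta,\Psi\vdash\theta$ and $\Phi,e,\Psi\vdash\theta$ with $\Phi,\Psi\vdash\theta$. *Structures.* An $Sg$-structure $S$ in $(\mathcal C,P)\in\mathrm{Ob}(\mathbf{FA})$ assigns an object $[\![\sigma]\!]$ to each sort, a morphism $[\![f]\!]\colon[\![\sigma_1]\!]\times\cdots\times[\![\sigma_n]\!]\to[\![\tau]\!]$ to each function symbol and $[\![R]\!]\in P([\![\sigma_1]\!]\times\cdots\times[\![\sigma_n]\!])$ to each relation symbol. Products $c_1\times\cdots\times c_n$ are bracketed to the left, and are $1$ for $n=0$ and $c_1$ for $n=1$. With $[\![x_1:\sigma_1,\dots,x_n:\sigma_n]\!]=[\![\sigma_1]\!]\times\cdots\times[\![\sigma_n]\!]$, put $[\![x_i\,[\Gamma]]\!]=\pi_i$,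 $[\![f(M_1,\dots,M_n)]\!]=[\![f]\!]\circ\langle[\![M_1]\!],\dots,[\![M_n]\!]\rangle$, $[\![R(M_1,\dots,M_n)]\!]=P(\langle[\![M_1]\!],\dots,[\![M_n]\!]\rangle)[\![R]\!]$, $[\![M_1=_\tau M_2]\!]=P(\langle[\![M_1]\!],[\![M_2]\!]\rangle)Eq_{[\![\tau]\!]}$, $[\![\Diamond(\phi_1,\dots,\phi_n)]\!]=\Diamond([\![\phi_1]\!],\dots,[\![\phi_n]\!])$, and $[\![\Omega_{x:\sigma}(\phi)\,[\Gamma]]\!]=\Omega_{[\![\Gamma]\!],[\![\sigma]\!]}(P(a)[\![\phi\,[\Gamma,x:\sigma]]\!])$ with $a\colon[\![\Gamma]\!]\times[\![\sigma]\!]\to[\![\Gamma,x:\sigma]\!]$ the canonical isomorphism. $S$ satisfies $M=N:\tau\,[\Gamma]$ if $[\![M]\!]=[\![N]\!]$, and $\phi_1,\dots,\phi_n\vdash\psi\,[\Gamma]$ if $[\![\phi_1]\!]\otimes\cdots\otimes[\![\phi_n]\!]\le[\![\psi]\!]$ (the left side being $e_{[\![\Gamma]\!]}$ if $n=0$). $\mathrm{Th}(S)$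 is the set of assertions that $S$ satisfies; it is closed under $\mathcal L^m$. *Classifying prop-category.* Let $T$ be an $Sg$-theory closed under $\mathcal L^m$. The objects of $\mathcal C_T$ are the contexts; a morphism $\Gamma'\to\Gamma=x_1:\sigma_1,\dots,x_n:\sigma_n$ is a list of terms $N_i:\sigma_i\,[\Gamma']$, each up to provable equality ($N=M:\sigma\,[\Gamma']\in T$); composition is substitution; and $\Gamma\times\Gamma'=\Gamma,\Gamma'$. $P_T(\Gamma)$ is the set of formulas $\phi\,[\Gamma]$ modulo $\phi\vdash\psi,\ \psi\vdash\phi\in T$, ordered by $\phi\vdash\psi\in T$; $P_T$ acts on morphisms by simultaneous substitution, connectives act on representatives, $\Omega_{\Gamma,\Gamma'}(\phi)=\Omega_{y_1:\tau_1}\cdots\Omega_{y_m:\tau_m}(\phi)\,[\Gamma]$ for $\Gamma'=y_1:\tau_1,\dots,y_m:\tau_m$, and $Eq_\Gamma=(x_1=_{\sigma_1}x_1'\otimes\cdots\otimes x_n=_{\sigma_n}x_n')\,[\Gamma,\Gamma']$, where $\Gamma'$ is a renamed copy of $\Gamma$ ($Eq_\Gamma=e$ if $n=0$). Then $(\mathcal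 C_T,P_T)\in\mathrm{Ob}(\mathbf{FA})$. If $S$ is an $Sg$-structure in $(\mathcal C,P)$ with $T\subseteq\mathrm{Th}(S)$, the induced morphism $\overline S\colon(\mathcal C_T,P_T)\to(\mathcal C,P)$ of $\mathbf{FA}$ is given by $\overline S^o(\Gamma)=[\![\Gamma]\!]$, $\overline S^o([M_1,\dots,M_n])=\langle[\![M_1]\!],\dots,[\![M_n]\!]\rangle$ and $\overline S^p_\Gamma(\phi)=[\![\phi\,[\Gamma]]\!]$. *Internal structure.* For $(\mathcal C,P)\in\mathrm{Ob}(\mathbf{FA})$, the internal signature has as sorts the objects of $\mathcal C$, as function symbols $c_1,\dots,c_n\to c$ the morphisms $c_1\times\cdots\times c_n\to c$ of $\mathcal C$, and as relation symbols on $c_1,\dots,c_n$ the elements of $P(c_1\times\cdots\times c_n)$, for all $n\ge0$. The internal structure interprets each of these symbols by itself. **Proposition.** Let $(\mathcal C,P)\in\mathrm{Ob}(\mathbf{FA})$, let $S$ be the internal structure of $(\mathcal C,P)$, and let $T=\mathrm{Th}(S)$. Then the induced morphism $\overline S\colon(\mathcal C_T,P_T)\to(\mathcal C,P)$ is a 2-equivalence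 in $\mathbf{FA}$. -/

import Mathlib

namespace FibLog

open CategoryTheory MonoidalCategory CartesianMonoidalCategory Opposite

set_option linter.checkUnivs false

universe q k s f r u v w u' v' w' u'' v'' w''

/-! ### Syntax -/

/-- A first-order language: quantifier symbols, propositional connectives with arities, and the
designated connectives `e` (arity `0`) and `⊗` (arity `2`). -/
structure Language where
  Quant : Type q
  Conn : ℕ → Type k
  e : Conn 0
  tensor : Conn 2

/-- A many-sorted signature. The list of argument sorts `σ₁, …, σₙ` of a symbol is stored, as all
contexts below, with its last entry first, i.e. as `[σₙ, …, σ₁]`. -/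
structure Signature where
  Srt : Type s
  Fn : List Srt → Srt → Type f
  Rel : List Srt → Type r

/-- `Var Γ σ`: the variables of sort `σ` in the context `Γ`. Contexts are taken up to renaming of
their variables, so a context `x₁ : σ₁, …, xₙ : σₙ` is the list `[σₙ, …, σ₁]` (last variable at the
head) and the variables are the positions in it. The context `Γ, Γ'` is `Γ' ++ Γ`. -/
inductive Var {S : Type s} : List S → S → Type s
  | zero {Γ : List S} {σ : S} : Var (σ :: Γ) σ
  | succ {Γ : List S} {σ τ : S} : Var Γ σ → Var (τ :: Γ) σ

namespace Var

variable {S : Type s}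

/-- The variables of `Γ` in `Γ, Γ'`. -/
def right {Γ : List S} {σ : S} : (Γ' : List S) → Var Γ σ → Var (Γ' ++ Γ) σ
  | [], x => x
  | _ :: Γ', x => succ (right Γ' x)

/-- The variables of `Γ'` in `Γ, Γ'`. -/
def left {Γ : List S} {σ : S} : {Γ' : List S} → Var Γ' σ → Var (Γ' ++ Γ) σ
  | _ :: _, zero => zero
  | _ :: _, succ x => succ (left x)

theorem left_injective {Γ Γ' : List S} {σ : S} :
    Function.Injective (left : Var Γ' σ → Var (Γ' ++ Γ) σ) := by
  induction Γ' with
  | nil => intro x; nomatch x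
  | cons τ Γ' ih =>
    intro x y h
    cases x with
    | zero =>
      cases y with
      | zero => rfl
      | succ y => simp [left] at h
    | succ x =>
      cases y with
      | zero => simp [left] at h
      | succ y =>
        exact congrArg succ (ih (by simpa [left] using h))

end Var

/-- Well-formed terms-in-context `M : τ [Γ]`. -/
inductive Term (Sg : Signature.{s, f, r}) (Γ : List Sg.Srt) : Sg.Srt → Type (max s f)
  | var {σ : Sg.Srt} (x : Var Γ σ) : Term Sg Γ σ
  | app {Δ : List Sg.Srt} {τ : Sg.Srt} (h : Sg.Fn Δ τ)
      (M : ∀ σ, Var Δ σ → Term Sg Γ σ) : Term Sg Γ τ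

/-- Lists of terms in the context `Δ`, one for each variable of `Γ`. -/
abbrev Subst (Sg : Signature.{s, f, r}) (Δ Γ : List Sg.Srt) : Type (max s f) :=
  ∀ σ, Var Γ σ → Term Sg Δ σ

variable {L : Language.{q, k}} {Sg : Signature.{s, f, r}}

/-- Simultaneous substitution in a term. -/
def Term.subst {Δ Γ : List Sg.Srt} (γ : Subst Sg Δ Γ) {τ : Sg.Srt} : Term Sg Γ τ → Term Sg Δ τ
  | .var x => γ _ x
  | .app h M => .app h (fun σ x => (M σ x).subst γ)

namespace Subst

/-- The identity substitution. -/
def ids (Γ : List Sg.Srt) : Subst Sg Γ Γ := fun _ x => .var x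

/-- Composition of `γ : Δ → Γ` and `δ : Γ → Θ`. -/
def comp {Δ Γ Θ : List Sg.Srt} (γ : Subst Sg Δ Γ) (δ : Subst Sg Γ Θ) : Subst Sg Δ Θ :=
  fun σ x => (δ σ x).subst γ

/-- Extension of a list of terms by one term. -/
def cons {Δ Γ : List Sg.Srt} {σ : Sg.Srt} (M : Term Sg Δ σ) (γ : Subst Sg Δ Γ) :
    Subst Sg Δ (σ :: Γ)
  | _, .zero => M
  | _, .succ x => γ _ x

/-- Renaming of variables, as a substitution. -/
def ofRen {Δ Γ : List Sg.Srt} (ρ : ∀ σ, Var Γ σ → Var Δ σ) : Subst Sg Δ Γ :=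
  fun σ x => .var (ρ σ x)

/-- Weakening by one variable. -/
def wk (Γ : List Sg.Srt) (σ : Sg.Srt) : Subst Sg (σ :: Γ) Γ := ofRen (fun _ x => x.succ)

/-- The substitution that acts as `γ` and fixes one further variable. -/
def lift {Δ Γ : List Sg.Srt} (γ : Subst Sg Δ Γ) (σ : Sg.Srt) : Subst Sg (σ :: Δ) (σ :: Γ) :=
  cons (.var .zero) (comp (wk Δ σ) γ)

/-- The list of terms `γ, δ` for the context `Γ, Γ'`. -/
def append {Ξ Γ : List Sg.Srt} : (Γ' : List Sg.Srt) → Subst Sg Ξ Γ → Subst Sg Ξ Γ' →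
    Subst Sg Ξ (Γ' ++ Γ)
  | [], γ, _ => γ
  | _ :: Γ', γ, δ => cons (δ _ .zero) (append Γ' γ (fun _ x => δ _ x.succ))

/-- Given terms for the context `Γ, Γ'` and a term `M : σ`, the corresponding terms for the
context `Γ, x : σ, Γ'`, with `M` for `x`. -/
def insert {Ξ Γ : List Sg.Srt} {σ : Sg.Srt} : (Γ' : List Sg.Srt) → Subst Sg Ξ (Γ' ++ Γ) →
    Term Sg Ξ σ → Subst Sg Ξ (Γ' ++ σ :: Γ)
  | [], γ, M => cons M γ
  | _ :: Γ', γ, M => cons (γ _ .zero) (insert Γ' (fun _ x => γ _ x.succ) M)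

/-- The substitution `[M/x]` from the context `Γ, x : σ, Γ'` to the context `Γ, Γ'`. -/
def single {Γ : List Sg.Srt} {σ : Sg.Srt} (Γ' : List Sg.Srt) (M : Term Sg (Γ' ++ Γ) σ) :
    Subst Sg (Γ' ++ Γ) (Γ' ++ σ :: Γ) :=
  insert Γ' (ids _) M

end Subst

/-- Well-formed formulas-in-context `φ : prop [Γ]`; a bound variable is the last variable of the
context of its scope, so that `α`-equivalent formulas are equal. -/
inductive Formula (L : Language.{q, k}) (Sg : Signature.{s, f, r}) :
    List Sg.Srt → Type (max q k s f r)
  | rel {Γ Δ : List Sg.Srt} (R : Sg.Rel Δ) (M : Subst Sg Γ Δ) : Formula L Sg Γ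
  | eq {Γ : List Sg.Srt} {σ : Sg.Srt} (M N : Term Sg Γ σ) : Formula L Sg Γ
  | conn {Γ : List Sg.Srt} {n : ℕ} (o : L.Conn n) (φ : Fin n → Formula L Sg Γ) : Formula L Sg Γ
  | quant {Γ : List Sg.Srt} (Ω : L.Quant) (σ : Sg.Srt) (φ : Formula L Sg (σ :: Γ)) :
      Formula L Sg Γ

namespace Formula

/-- Simultaneous (capture-avoiding) substitution in a formula. -/
def subst {Γ : List Sg.Srt} (φ : Formula L Sg Γ) :
    {Δ : List Sg.Srt} → Subst Sg Δ Γ → Formula L Sg Δ :=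
  match φ with
  | rel R M => fun γ => rel R (γ.comp M)
  | eq M N => fun γ => eq (M.subst γ) (N.subst γ)
  | conn o φ => fun γ => conn o (fun i => (φ i).subst γ)
  | quant Ω σ φ => fun γ => quant Ω σ (φ.subst (γ.lift σ))

/-- The formula `e`. -/
def e {Γ : List Sg.Srt} : Formula L Sg Γ := conn L.e ![]

/-- The formula `φ ⊗ ψ`. -/
def tensor {Γ : List Sg.Srt} (φ ψ : Formula L Sg Γ) : Formula L Sg Γ := conn L.tensor ![φ, ψ]

/-- The formula `Ω_{y₁:τ₁} ⋯ Ω_{yₘ:τₘ} φ [Γ]` for `φ [Γ, y₁:τ₁, …, yₘ:τₘ]`. -/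
def quants {Γ : List Sg.Srt} (Ω : L.Quant) :
    (Γ' : List Sg.Srt) → Formula L Sg (Γ' ++ Γ) → Formula L Sg Γ
  | [], φ => φ
  | τ :: Γ', φ => quants Ω Γ' (quant Ω τ φ)

/-- For lists of terms `M₁, …, Mₙ` and `N₁, …, Nₙ` of the sorts in `Γ`, the formula
`M₁ = N₁ ⊗ ⋯ ⊗ Mₙ = Nₙ`; it is `e` for `n = 0`. -/
def eqs {Δ : List Sg.Srt} : (Γ : List Sg.Srt) → Subst Sg Δ Γ → Subst Sg Δ Γ → Formula L Sg Δ
  | [], _, _ => e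
  | [_], γ, δ => eq (γ _ .zero) (δ _ .zero)
  | _ :: τ :: Γ, γ, δ =>
    tensor (eqs (τ :: Γ) (fun _ x => γ _ x.succ) (fun _ x => δ _ x.succ))
      (eq (γ _ .zero) (δ _ .zero))

end Formula

/-- Assertions: equations-in-context `M = N : σ [Γ]` and sequents-in-context `Φ ⊢ ψ [Γ]`. -/
inductive Assertion (L : Language.{q, k}) (Sg : Signature.{s, f, r}) : Type (max q k s f r)
  | eqn {Γ : List Sg.Srt} {σ : Sg.Srt} (M N : Term Sg Γ σ) : Assertion L Sg
  | seq {Γ : List Sg.Srt} (Φ : List (Formula L Sg Γ)) (ψ : Formula L Sg Γ) : Assertion L Sg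

/-- A theory over the signature `Sg`. -/
abbrev Theory (L : Language.{q, k}) (Sg : Signature.{s, f, r}) : Type (max q k s f r) :=
  Set (Assertion L Sg)

open Assertion in
/-- `T` is closed under the rules of equational logic and of the minimal logic `ℒᵐ`. In the two
substitution rules `ρ` witnesses that the variables of `Δ` are among those of `Γ, Γ'`. -/
structure Theory.IsLm (T : Theory L Sg) : Prop where
  eqn_refl {Γ : List Sg.Srt} {σ : Sg.Srt} (M : Term Sg Γ σ) : eqn M M ∈ T
  eqn_symm {Γ : List Sg.Srt} {σ : Sg.Srt} {M N : Term Sg Γ σ} : eqn M N ∈ T → eqn N M ∈ T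
  eqn_trans {Γ : List Sg.Srt} {σ : Sg.Srt} {M N K : Term Sg Γ σ} :
    eqn M N ∈ T → eqn N K ∈ T → eqn M K ∈ T
  eqn_sub {Γ Γ' Δ : List Sg.Srt} {σ τ : Sg.Srt} (ρ : ∀ σ, Var Δ σ → Var (Γ' ++ Γ) σ)
    (hρ : ∀ σ, Function.Injective (ρ σ)) {M M' : Term Sg Δ σ}
    {N N' : Term Sg (Γ' ++ σ :: Γ) τ} : eqn M M' ∈ T → eqn N N' ∈ T →
    eqn (N.subst (.single Γ' (M.subst (.ofRen ρ))))
      (N'.subst (.single Γ' (M'.subst (.ofRen ρ)))) ∈ T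
  ax {Γ : List Sg.Srt} (φ : Formula L Sg Γ) : seq [φ] φ ∈ T
  cut {Γ : List Sg.Srt} {φ ψ θ : Formula L Sg Γ} : seq [φ] ψ ∈ T → seq [ψ] θ ∈ T → seq [φ] θ ∈ T
  cwk {Γ : List Sg.Srt} (σ : Sg.Srt) {Φ : List (Formula L Sg Γ)} {ψ : Formula L Sg Γ} :
    seq Φ ψ ∈ T → seq (Φ.map fun φ => φ.subst (.wk Γ σ)) (ψ.subst (.wk Γ σ)) ∈ T
  sub {Γ Γ' Δ : List Sg.Srt} {σ : Sg.Srt} (ρ : ∀ σ, Var Δ σ → Var (Γ' ++ Γ) σ)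
    (hρ : ∀ σ, Function.Injective (ρ σ)) {M M' : Term Sg Δ σ}
    {Φ : List (Formula L Sg (Γ' ++ σ :: Γ))} {ψ : Formula L Sg (Γ' ++ σ :: Γ)} :
    eqn M M' ∈ T → seq Φ ψ ∈ T →
    seq (Φ.map fun φ => φ.subst (.single Γ' (M.subst (.ofRen ρ))))
      (ψ.subst (.single Γ' (M'.subst (.ofRen ρ)))) ∈ T
  quant_cong {Γ : List Sg.Srt} (Ω : L.Quant) (σ : Sg.Srt) {φ ψ : Formula L Sg (σ :: Γ)} :
    seq [φ] ψ ∈ T → seq [ψ] φ ∈ T → seq [φ.quant Ω σ] (ψ.quant Ω σ) ∈ T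
  conn_cong {Γ : List Sg.Srt} {n : ℕ} (o : L.Conn n) {φ ψ : Fin n → Formula L Sg Γ} :
    (∀ i, seq [φ i] (ψ i) ∈ T) → (∀ i, seq [ψ i] (φ i) ∈ T) → seq [.conn o φ] (.conn o ψ) ∈ T
  tensor_ref {Γ : List Sg.Srt} {Φ Ψ : List (Formula L Sg Γ)} {α β θ : Formula L Sg Γ} :
    seq (Φ ++ α :: β :: Ψ) θ ∈ T ↔ seq (Φ ++ α.tensor β :: Ψ) θ ∈ T
  e_ref {Γ : List Sg.Srt} {Φ Ψ : List (Formula L Sg Γ)} {θ : Formula L Sg Γ} :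
    seq (Φ ++ .e :: Ψ) θ ∈ T ↔ seq (Φ ++ Ψ) θ ∈ T

/-! ### Substitution calculus -/

theorem Term.subst_subst {Δ Γ Θ : List Sg.Srt} (γ : Subst Sg Δ Γ) (δ : Subst Sg Γ Θ)
    {τ : Sg.Srt} (M : Term Sg Θ τ) : (M.subst δ).subst γ = M.subst (γ.comp δ) := by
  induction M with
  | var x => rfl
  | app h M ih => simp only [subst, ih]

theorem Term.subst_ids {Γ : List Sg.Srt} {τ : Sg.Srt} (M : Term Sg Γ τ) :
    M.subst (.ids Γ) = M := by
  induction M with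
  | var x => rfl
  | app h M ih => simp only [subst, ih]

namespace Subst

theorem comp_assoc {Δ Γ Θ Ξ : List Sg.Srt} (γ : Subst Sg Δ Γ) (δ : Subst Sg Γ Θ)
    (ε : Subst Sg Θ Ξ) : (γ.comp δ).comp ε = γ.comp (δ.comp ε) := by
  funext σ x; exact (Term.subst_subst γ δ _).symm

theorem ids_comp {Δ Γ : List Sg.Srt} (γ : Subst Sg Δ Γ) : (ids Δ).comp γ = γ := by
  funext σ x; exact Term.subst_ids _

theorem comp_ids {Δ Γ : List Sg.Srt} (γ : Subst Sg Δ Γ) : γ.comp (ids Γ) = γ := rfl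

theorem comp_cons {Ξ Δ Γ : List Sg.Srt} {σ : Sg.Srt} (ε : Subst Sg Ξ Δ) (M : Term Sg Δ σ)
    (γ : Subst Sg Δ Γ) : ε.comp (cons M γ) = cons (M.subst ε) (ε.comp γ) := by
  funext τ x; cases x <;> rfl

theorem cons_eta {Δ Γ : List Sg.Srt} {σ : Sg.Srt} (γ : Subst Sg Δ (σ :: Γ)) :
    cons (γ σ .zero) (fun _ x => γ _ x.succ) = γ := by
  funext τ x; cases x <;> rfl

theorem cons_comp_wk {Δ Γ : List Sg.Srt} {σ : Sg.Srt} (M : Term Sg Δ σ) (γ : Subst Sg Δ Γ) :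
    (cons M γ).comp (wk Γ σ) = γ := rfl

theorem lift_ids (Γ : List Sg.Srt) (σ : Sg.Srt) : (ids (Sg := Sg) Γ).lift σ = ids (σ :: Γ) := by
  funext τ x; cases x <;> rfl

theorem lift_comp {Δ Γ Θ : List Sg.Srt} (γ : Subst Sg Δ Γ) (δ : Subst Sg Γ Θ) (σ : Sg.Srt) :
    (γ.lift σ).comp (δ.lift σ) = (γ.comp δ).lift σ := by
  funext τ x
  cases x with
  | zero => rfl
  | succ x =>
    change ((δ τ x).subst _).subst _ = ((δ τ x).subst _).subst _
    rw [Term.subst_subst, Term.subst_subst]; rfl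

theorem comp_append {Ξ Δ Γ : List Sg.Srt} (ε : Subst Sg Ξ Δ) :
    (Γ' : List Sg.Srt) → (γ : Subst Sg Δ Γ) → (δ : Subst Sg Δ Γ') →
    ε.comp (append Γ' γ δ) = append Γ' (ε.comp γ) (ε.comp δ)
  | [], _, _ => rfl
  | _ :: Γ', γ, _ => by rw [append, comp_cons, comp_append]; rfl

theorem append_right {Δ Γ : List Sg.Srt} :
    (Γ' : List Sg.Srt) → (γ : Subst Sg Δ Γ) → (δ : Subst Sg Δ Γ') → ∀ {σ} (x : Var Γ σ),
    append Γ' γ δ σ (x.right Γ') = γ σ x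
  | [], _, _, _, _ => rfl
  | _ :: Γ', γ, δ, _, x => append_right Γ' γ _ x

theorem append_left {Δ Γ : List Sg.Srt} :
    (Γ' : List Sg.Srt) → (γ : Subst Sg Δ Γ) → (δ : Subst Sg Δ Γ') → ∀ {σ} (x : Var Γ' σ),
    append Γ' γ δ σ x.left = δ σ x
  | [], _, _, _, x => nomatch x
  | _ :: _, _, _, _, .zero => rfl
  | _ :: Γ', γ, _, _, .succ x => append_left Γ' γ _ x

theorem append_eta {Δ Γ : List Sg.Srt} :
    (Γ' : List Sg.Srt) → (γ : Subst Sg Δ (Γ' ++ Γ)) →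
    append Γ' (fun _ x => γ _ (x.right Γ')) (fun _ x => γ _ x.left) = γ
  | [], _ => rfl
  | _ :: Γ', γ => by
    refine Eq.trans ?_ (cons_eta γ)
    exact congrArg (cons _) (append_eta Γ' (fun _ x => γ _ x.succ))

theorem comp_insert {Ξ Δ Γ : List Sg.Srt} {σ : Sg.Srt} (ε : Subst Sg Ξ Δ) :
    (Γ' : List Sg.Srt) → (γ : Subst Sg Δ (Γ' ++ Γ)) → (M : Term Sg Δ σ) →
    ε.comp (insert Γ' γ M) = insert Γ' (ε.comp γ) (M.subst ε)
  | [], _, _ => comp_cons ..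
  | _ :: Γ', γ, M => by rw [insert, comp_cons, comp_insert]; rfl

theorem insert_append {Ξ Γ : List Sg.Srt} {σ : Sg.Srt} (M : Term Sg Ξ σ) :
    (Γ' : List Sg.Srt) → (γ : Subst Sg Ξ Γ) → (δ : Subst Sg Ξ Γ') →
    insert Γ' (append Γ' γ δ) M = append Γ' (cons M γ) δ
  | [], _, _ => rfl
  | _ :: Γ', γ, _ => congrArg (cons _) (insert_append M Γ' γ _)

theorem append_nil_eq_var {Ξ : List Sg.Srt} (γ : Subst Sg Ξ []) (Γ' : List Sg.Srt) :
    ∀ (Θ : List Sg.Srt) (h : Θ = Γ' ++ []) (h' : Θ = Γ') (δ : Subst Sg Ξ Γ')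
    {σ : Sg.Srt} (x : Var Θ σ), append Γ' γ δ σ (h ▸ x) = δ σ (h' ▸ x) := by
  induction Γ' with
  | nil => intro Θ h h' δ σ x; subst h'; nomatch x
  | cons τ Γ' ih =>
    intro Θ h h' δ σ x
    subst h'
    have h2 : Γ' = Γ' ++ [] := (List.append_nil Γ').symm
    have key : ∀ (Γ₂ : List Sg.Srt) (e : τ :: Γ' = τ :: Γ₂) (e' : Γ' = Γ₂) {σ : Sg.Srt}
        (y : Var Γ' σ), (e ▸ y.succ : Var (τ :: Γ₂) σ) = (e' ▸ y : Var Γ₂ σ).succ := by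
      intro Γ₂ e e' σ y; subst e'; rfl
    have key0 : ∀ (Γ₂ : List Sg.Srt) (e : τ :: Γ' = τ :: Γ₂),
        (e ▸ (Var.zero : Var (τ :: Γ') τ) : Var (τ :: Γ₂) τ) = .zero := by
      intro Γ₂ e; cases e; rfl
    have h1 : τ :: Γ' = τ :: (Γ' ++ []) := h
    cases x with
    | zero => exact congrArg (append (τ :: Γ') γ δ τ) (key0 (Γ' ++ []) h1)
    | succ x =>
      refine (congrArg (append (τ :: Γ') γ δ σ) (key (Γ' ++ []) h1 h2 x)).trans ?_
      exact ih Γ' h2 rfl (fun _ x => δ _ x.succ) x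

end Subst

theorem Formula.subst_ids {Γ : List Sg.Srt} (φ : Formula L Sg Γ) : φ.subst (.ids Γ) = φ := by
  induction φ with
  | rel R M => simp only [subst, Subst.ids_comp]
  | eq M N => simp only [subst, Term.subst_ids]
  | conn o φ ih => simp only [subst, ih]
  | quant Ω σ φ ih => simp only [subst, Subst.lift_ids, ih]

theorem Formula.subst_subst {Θ : List Sg.Srt} (φ : Formula L Sg Θ) :
    ∀ {Δ Γ : List Sg.Srt} (γ : Subst Sg Δ Γ) (δ : Subst Sg Γ Θ),
    (φ.subst δ).subst γ = φ.subst (γ.comp δ) := by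
  induction φ with
  | rel R M => intros; simp only [subst, Subst.comp_assoc]
  | eq M N => intros; simp only [subst, Term.subst_subst]
  | conn o φ ih => intros; simp only [subst, ih]
  | quant Ω σ φ ih => intros; simp only [subst, ih, Subst.lift_comp]

theorem Formula.subst_e {Δ Γ : List Sg.Srt} (γ : Subst Sg Δ Γ) :
    (e : Formula L Sg Γ).subst γ = e := by
  simp only [e, subst]; congr 1; funext i; exact i.elim0

theorem Formula.subst_tensor {Δ Γ : List Sg.Srt} (γ : Subst Sg Δ Γ) (φ ψ : Formula L Sg Γ) :
    (φ.tensor ψ).subst γ = (φ.subst γ).tensor (ψ.subst γ) := by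
  simp only [tensor, subst]; congr 1; funext i; fin_cases i <;> rfl

theorem Formula.subst_eqs {Ξ Δ : List Sg.Srt} (ε : Subst Sg Ξ Δ) :
    (Γ : List Sg.Srt) → (γ δ : Subst Sg Δ Γ) →
    (eqs Γ γ δ : Formula L Sg Δ).subst ε = eqs Γ (ε.comp γ) (ε.comp δ)
  | [], _, _ => subst_e ε
  | [_], _, _ => rfl
  | _ :: τ :: Γ, γ, δ => by
    rw [eqs, subst_tensor, subst_eqs ε (τ :: Γ)]; rfl

/-- Two lists of terms are equal componentwise, modulo `T`. -/
def Theory.SubEq (T : Theory L Sg) {Δ Γ : List Sg.Srt} (γ δ : Subst Sg Δ Γ) : Prop :=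
  ∀ σ (x : Var Γ σ), Assertion.eqn (γ σ x) (δ σ x) ∈ T

/-- Closure under weakening and under substitution for single variables implies closure under
simultaneous substitution. -/
theorem simultaneous (T : Theory L Sg) {X Y : List Sg.Srt → Type*}
    (sx : ∀ {Δ Γ : List Sg.Srt}, Subst Sg Δ Γ → X Γ → X Δ)
    (sy : ∀ {Δ Γ : List Sg.Srt}, Subst Sg Δ Γ → Y Γ → Y Δ)
    (sx_ids : ∀ {Γ} (x : X Γ), sx (.ids Γ) x = x) (sy_ids : ∀ {Γ} (y : Y Γ), sy (.ids Γ) y = y)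
    (sx_comp : ∀ {Δ Γ Θ} (γ : Subst Sg Δ Γ) (δ : Subst Sg Γ Θ) (x : X Θ),
      sx γ (sx δ x) = sx (γ.comp δ) x)
    (sy_comp : ∀ {Δ Γ Θ} (γ : Subst Sg Δ Γ) (δ : Subst Sg Γ Θ) (y : Y Θ),
      sy γ (sy δ y) = sy (γ.comp δ) y)
    (Q : ∀ Γ, X Γ → Y Γ → Prop)
    (hwk : ∀ {Γ} (σ : Sg.Srt) {x : X Γ} {y : Y Γ}, Q Γ x y →
      Q (σ :: Γ) (sx (.wk Γ σ) x) (sy (.wk Γ σ) y))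
    (hsub : ∀ {Γ Γ' Δ : List Sg.Srt} {σ : Sg.Srt} (ρ : ∀ σ, Var Δ σ → Var (Γ' ++ Γ) σ)
      (_ : ∀ σ, Function.Injective (ρ σ)) {M M' : Term Sg Δ σ}
      {x : X (Γ' ++ σ :: Γ)} {y : Y (Γ' ++ σ :: Γ)}, Assertion.eqn M M' ∈ T → Q _ x y →
      Q _ (sx (.single Γ' (M.subst (.ofRen ρ))) x) (sy (.single Γ' (M'.subst (.ofRen ρ))) y))
    {Δ Γ : List Sg.Srt} {γ γ' : Subst Sg Δ Γ} (h : T.SubEq γ γ') {x : X Γ} {y : Y Γ}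
    (hxy : Q Γ x y) : Q Δ (sx γ x) (sy γ' y) := by
  have weaken : ∀ (Γ' : List Sg.Srt), Q (Γ' ++ Γ) (sx (.ofRen fun _ x => x.right Γ') x)
      (sy (.ofRen fun _ x => x.right Γ') y) := by
    intro Γ'
    induction Γ' with
    | nil =>
      have h1 := sx_ids x
      have h2 := sy_ids y
      have h3 : Q Γ (sx (.ids Γ) x) (sy (.ids Γ) y) := by rw [h1, h2]; exact hxy
      exact h3
    | cons σ Γ' ih =>
      have := hwk σ ih
      rw [sx_comp, sy_comp] at this
      exact this
  have main : ∀ (Γ : List Sg.Srt) {γ γ' : Subst Sg Δ Γ} (_ : T.SubEq γ γ') {x : X (Δ ++ Γ)}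
      {y : Y (Δ ++ Γ)} (_ : Q _ x y), Q Δ (sx (.append Δ γ (.ids Δ)) x)
        (sy (.append Δ γ' (.ids Δ)) y) := by
    intro Γ
    induction Γ with
    | nil =>
      intro γ γ' _ x y hQ
      have key : ∀ (Θ : List Sg.Srt) (h : Θ = Δ) (δ δ' : Subst Sg Δ Θ)
          (_ : ∀ σ x, δ σ x = .var (h ▸ x)) (_ : ∀ σ x, δ' σ x = .var (h ▸ x)) {x : X Θ} {y : Y Θ}
          (_ : Q _ x y), Q Δ (sx δ x) (sy δ' y) := by
        clear hQ
        intro Θ h δ δ' hd hd' x y hQ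
        subst h
        have e1 : δ = .ids _ := by funext σ x; exact hd σ x
        have e2 : δ' = .ids _ := by funext σ x; exact hd' σ x
        rw [e1, e2, sx_ids, sy_ids]; exact hQ
      refine key _ (List.append_nil Δ) _ _ ?_ ?_ hQ <;>
      · intro σ x
        exact Subst.append_nil_eq_var _ Δ (Δ ++ []) rfl (List.append_nil Δ) (.ids Δ) x
    | cons σ Γ ih =>
      intro γ γ' h x y hQ
      have h1 := hsub (Γ := Γ) (Γ' := Δ) (Δ := Δ) (σ := σ) (fun _ x => x.left)
        (fun _ => Var.left_injective) (h σ .zero) hQ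
      have h2 := ih (γ := fun _ x => γ _ x.succ) (γ' := fun _ x => γ' _ x.succ)
        (fun τ x => h τ x.succ) h1
      have e : ∀ γ : Subst Sg Δ (σ :: Γ),
          (Subst.append Δ (fun _ x => γ _ x.succ) (.ids Δ)).comp
            (.single Δ ((γ σ .zero).subst (.ofRen fun _ x => x.left))) =
          Subst.append Δ γ (.ids Δ) := by
        intro γ
        rw [Subst.single, Subst.comp_insert, Subst.comp_ids, Term.subst_subst]
        have : (Subst.append Δ (fun _ x => γ _ x.succ) (.ids Δ)).comp
            (.ofRen fun _ x => x.left) = .ids Δ := by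
          funext τ x; exact Subst.append_left _ _ _ _
        rw [this, Term.subst_ids, Subst.insert_append, Subst.cons_eta]
      rw [sx_comp, sy_comp, e, e] at h2
      exact h2
  have := main Γ h (weaken Δ)
  rw [sx_comp, sy_comp] at this
  have e : ∀ γ : Subst Sg Δ Γ, (Subst.append Δ γ (.ids Δ)).comp
      (.ofRen fun _ x => x.right Δ) = γ := by
    intro γ; funext τ x; exact Subst.append_right _ _ _ _
  rwa [e, e] at this

namespace Theory.IsLm

variable {T : Theory L Sg}

theorem eqn_wk (hT : T.IsLm) {Γ : List Sg.Srt} (σ : Sg.Srt) {τ : Sg.Srt} {M N : Term Sg Γ τ}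
    (h : Assertion.eqn M N ∈ T) :
    Assertion.eqn (M.subst (.wk Γ σ)) (N.subst (.wk Γ σ)) ∈ T :=
  hT.eqn_sub (Γ := σ :: Γ) (Γ' := []) (Δ := Γ) (σ := τ) (fun _ x => x.succ)
    (fun _ _ _ h => by simpa using h) h (hT.eqn_refl (.var (.zero : Var (τ :: σ :: Γ) τ)))

theorem eqn_subst (hT : T.IsLm) {Δ Γ : List Sg.Srt} {γ γ' : Subst Sg Δ Γ} (h : T.SubEq γ γ') {τ : Sg.Srt}
    {M N : Term Sg Γ τ} (hM : Assertion.eqn M N ∈ T) :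
    Assertion.eqn (M.subst γ) (N.subst γ') ∈ T :=
  simultaneous T (X := fun Γ => Term Sg Γ τ) (Y := fun Γ => Term Sg Γ τ)
    (fun γ M => M.subst γ) (fun γ M => M.subst γ) Term.subst_ids Term.subst_ids
    (fun _ _ _ => Term.subst_subst _ _ _) (fun _ _ _ => Term.subst_subst _ _ _)
    (fun _ M N => Assertion.eqn M N ∈ T)
    (fun σ _ _ h => hT.eqn_wk σ h) (fun ρ hρ _ _ _ _ h h' => hT.eqn_sub ρ hρ h h') h hM

theorem seq_subst (hT : T.IsLm) {Δ Γ : List Sg.Srt} {γ γ' : Subst Sg Δ Γ} (h : T.SubEq γ γ')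
    {φ ψ : Formula L Sg Γ} (hs : Assertion.seq [φ] ψ ∈ T) :
    Assertion.seq [φ.subst γ] (ψ.subst γ') ∈ T :=
  simultaneous T (X := fun Γ => Formula L Sg Γ) (Y := fun Γ => Formula L Sg Γ)
    (fun γ M => M.subst γ) (fun γ M => M.subst γ) Formula.subst_ids Formula.subst_ids
    (fun _ _ _ => Formula.subst_subst _ _ _) (fun _ _ _ => Formula.subst_subst _ _ _)
    (fun _ M N => Assertion.seq [M] N ∈ T)
    (fun σ _ _ h => hT.cwk σ h) (fun ρ hρ _ _ _ _ h h' => hT.sub ρ hρ h h') h hs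

end Theory.IsLm

/-! ### Prop-categories -/

section

variable {C : Type u} [Category.{v} C]

/-- The underlying type of the poset `P(c)`. -/
abbrev Pr (P : Cᵒᵖ ⥤ PartOrd.{w}) (c : C) : Type w := P.obj (op c)

/-- The action `P(f) : P(c) → P(b)` of a morphism `f : b ⟶ c`. -/
def pb (P : Cᵒᵖ ⥤ PartOrd.{w}) {b c : C} (h : b ⟶ c) (x : Pr P c) : Pr P b := (P.map h.op).hom x

theorem pb_id (P : Cᵒᵖ ⥤ PartOrd.{w}) {c : C} (x : Pr P c) : pb P (𝟙 c) x = x := by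
  simp [pb]

theorem pb_comp (P : Cᵒᵖ ⥤ PartOrd.{w}) {a b c : C} (g : a ⟶ b) (h : b ⟶ c) (x : Pr P c) :
    pb P (g ≫ h) x = pb P g (pb P h x) := by
  simp [pb]

theorem pb_mono (P : Cᵒᵖ ⥤ PartOrd.{w}) {b c : C} (h : b ⟶ c) {x y : Pr P c} (hxy : x ≤ y) :
    pb P h x ≤ pb P h y := (P.map h.op).hom.monotone hxy

end

/-- The objects of the 2-category `FA`: prop-categories `(C, P)`, i.e. categories `C` with
designated finite products and contravariant functors `P` to posets, with interpretations of the
connectives, of equality and of the quantifiers subject to the stated conditions. -/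
structure FA (L : Language.{q, k}) where
  C : Type u
  [cat : Category.{v} C]
  [prod : CartesianMonoidalCategory C]
  P : Cᵒᵖ ⥤ PartOrd.{w}
  conn {n : ℕ} (o : L.Conn n) (c : C) : (Fin n → Pr P c) → Pr P c
  pb_conn {n : ℕ} (o : L.Conn n) {b c : C} (h : b ⟶ c) (x : Fin n → Pr P c) :
    pb P h (conn o c x) = conn o b (fun i => pb P h (x i))
  Eq (c : C) : Pr P (c ⊗ c)
  quant (Ω : L.Quant) (b c : C) : Pr P (b ⊗ c) → Pr P b
  pb_quant (Ω : L.Quant) {a b : C} (c : C) (h : a ⟶ b) (x : Pr P (b ⊗ c)) :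
    pb P h (quant Ω b c x) = quant Ω a c (pb P (h ▷ c) x)
  tensor_assoc (c : C) (x y z : Pr P c) :
    conn L.tensor c ![conn L.tensor c ![x, y], z] = conn L.tensor c ![x, conn L.tensor c ![y, z]]
  e_tensor (c : C) (x : Pr P c) : conn L.tensor c ![conn L.e c ![], x] = x
  tensor_e (c : C) (x : Pr P c) : conn L.tensor c ![x, conn L.e c ![]] = x
  quant_one (Ω : L.Quant) (b : C) (x : Pr P b) : quant Ω b (𝟙_ C) (pb P (fst b (𝟙_ C)) x) = x
  quant_prod (Ω : L.Quant) (b c d : C) (x : Pr P ((b ⊗ c) ⊗ d)) :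
    quant Ω b (c ⊗ d) (pb P (α_ b c d).inv x) = quant Ω b c (quant Ω (b ⊗ c) d x)
  Eq_one : Eq (𝟙_ C) = conn L.e (𝟙_ C ⊗ 𝟙_ C) ![]
  Eq_prod (c₁ c₂ : C) : Eq (c₁ ⊗ c₂) = conn L.tensor ((c₁ ⊗ c₂) ⊗ (c₁ ⊗ c₂))
    ![pb P (lift (fst (c₁ ⊗ c₂) (c₁ ⊗ c₂) ≫ fst c₁ c₂) (snd (c₁ ⊗ c₂) (c₁ ⊗ c₂) ≫ fst c₁ c₂))
        (Eq c₁),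
      pb P (lift (fst (c₁ ⊗ c₂) (c₁ ⊗ c₂) ≫ snd c₁ c₂) (snd (c₁ ⊗ c₂) (c₁ ⊗ c₂) ≫ snd c₁ c₂))
        (Eq c₂)]

namespace FA

attribute [instance] cat prod

variable {L : Language.{q, k}}

/-- The unit `e_c`. -/
abbrev e (A : FA.{q, k, u, v, w} L) (c : A.C) : Pr A.P c := A.conn L.e c ![]

/-- The monoid operation `⊗` of `P(c)`. -/
abbrev tensor (A : FA.{q, k, u, v, w} L) (c : A.C) (x y : Pr A.P c) : Pr A.P c :=
  A.conn L.tensor c ![x, y]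

/-- The product `x₁ ⊗ ⋯ ⊗ xₙ`, which is `e_c` for `n = 0`. -/
def tensorList (A : FA.{q, k, u, v, w} L) (c : A.C) (l : List (Pr A.P c)) : Pr A.P c :=
  l.foldr (A.tensor c) (A.e c)

theorem pb_e (A : FA.{q, k, u, v, w} L) {b c : A.C} (h : b ⟶ c) :
    pb A.P h (A.e c) = A.e b := by
  rw [e, A.pb_conn]; congr 1; funext i; exact i.elim0

theorem pb_tensor (A : FA.{q, k, u, v, w} L) {b c : A.C} (h : b ⟶ c) (x y : Pr A.P c) :
    pb A.P h (A.tensor c x y) = A.tensor b (pb A.P h x) (pb A.P h y) := by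
  rw [tensor, A.pb_conn]; congr 1; funext i; fin_cases i <;> rfl

theorem pb_tensorList (A : FA.{q, k, u, v, w} L) {b c : A.C} (h : b ⟶ c) (l : List (Pr A.P c)) :
    pb A.P h (A.tensorList c l) = A.tensorList b (l.map (pb A.P h)) := by
  induction l with
  | nil => exact A.pb_e h
  | cons x l ih =>
    change pb A.P h (A.tensor c x (A.tensorList c l)) = _
    rw [pb_tensor, ih]; rfl

theorem tensorList_append (A : FA.{q, k, u, v, w} L) (c : A.C) (l l' : List (Pr A.P c)) :
    A.tensorList c (l ++ l') = A.tensor c (A.tensorList c l) (A.tensorList c l') := by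
  induction l with
  | nil => exact (A.e_tensor c _).symm
  | cons x l ih =>
    change A.tensor c x (A.tensorList c (l ++ l')) =
      A.tensor c (A.tensor c x (A.tensorList c l)) (A.tensorList c l')
    rw [ih]; exact (A.tensor_assoc c _ _ _).symm

theorem tensorList_singleton (A : FA.{q, k, u, v, w} L) (c : A.C) (x : Pr A.P c) :
    A.tensorList c [x] = x := A.tensor_e c x

/-- Morphisms of `FA`: a finite product preserving functor `F^o` and a natural transformation
`F^p : P ⟹ Q ∘ F^o` compatible with connectives, quantifiers and equality. -/
structure Hom (A : FA.{q, k, u, v, w} L) (B : FA.{q, k, u', v', w'} L) where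
  o : A.C ⥤ B.C
  [preserves : Limits.PreservesFiniteProducts o]
  p (c : A.C) : Pr A.P c →o Pr B.P (o.obj c)
  natural {b c : A.C} (h : b ⟶ c) (x : Pr A.P c) : p b (pb A.P h x) = pb B.P (o.map h) (p c x)
  map_conn {n : ℕ} (i : L.Conn n) (c : A.C) (x : Fin n → Pr A.P c) :
    p c (A.conn i c x) = B.conn i (o.obj c) (fun j => p c (x j))
  map_quant (Ω : L.Quant) (b c : A.C) (x : Pr A.P (b ⊗ c)) :
    p b (A.quant Ω b c x) =
      B.quant Ω (o.obj b) (o.obj c) (pb B.P (inv (prodComparison o b c)) (p (b ⊗ c) x))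
  map_Eq (c : A.C) : p (c ⊗ c) (A.Eq c) = pb B.P (prodComparison o c c) (B.Eq (o.obj c))

attribute [instance] Hom.preserves

namespace Hom

/-- The identity morphism. -/
def id (A : FA.{q, k, u, v, w} L) : Hom A A where
  o := 𝟭 A.C
  p _ := OrderHom.id
  natural _ _ := rfl
  map_conn _ _ _ := rfl
  map_quant Ω b c x := by
    have : inv (prodComparison (𝟭 A.C) b c) = 𝟙 _ := by simp
    rw [this]; exact congrArg (A.quant Ω b c) (pb_id A.P x).symm
  map_Eq c := by
    have : prodComparison (𝟭 A.C) c c = 𝟙 _ := by simp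
    rw [this]; exact (pb_id A.P _).symm

/-- The composite `K ∘ F`. -/
def comp {A : FA.{q, k, u, v, w} L} {B : FA.{q, k, u', v', w'} L}
    {D : FA.{q, k, u'', v'', w''} L} (F : Hom A B) (K : Hom B D) : Hom A D where
  o := F.o ⋙ K.o
  p c := (K.p (F.o.obj c)).comp (F.p c)
  natural h x := by
    change K.p _ (F.p _ _) = _
    rw [F.natural, K.natural]; rfl
  map_conn i c x := by
    change K.p _ (F.p _ _) = _
    rw [F.map_conn, K.map_conn]; rfl
  map_quant Ω b c x := by
    change K.p _ (F.p _ _) = _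
    rw [F.map_quant, K.map_quant, K.natural, ← pb_comp]
    congr 2
    simp only [prodComparison_comp, IsIso.inv_comp, Functor.map_inv]
  map_Eq c := by
    change K.p _ (F.p _ _) = _
    rw [F.map_Eq, K.natural, K.map_Eq, ← pb_comp, prodComparison_comp]; rfl

end Hom

/-- 2-cells `η : F ⟹ H`: natural transformations `η : F^o ⟹ H^o` with `F^p = Qη · H^p`. -/
structure TwoCell {A : FA.{q, k, u, v, w} L} {B : FA.{q, k, u', v', w'} L} (F H : Hom A B) where
  nt : F.o ⟶ H.o
  comm (c : A.C) (x : Pr A.P c) : F.p c x = pb B.P (nt.app c) (H.p c x)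

/-- `F` and `H` are 2-isomorphic: there is a 2-cell that is a natural isomorphism. -/
def TwoIsomorphic {A : FA.{q, k, u, v, w} L} {B : FA.{q, k, u', v', w'} L} (F H : Hom A B) :
    Prop :=
  ∃ η : TwoCell F H, IsIso η.nt

/-- `F : A ⟶ B` is a 2-equivalence (an equivalence in the 2-category `FA`): it has a
pseudo-inverse up to 2-isomorphism. -/
def Hom.IsTwoEquivalence {A : FA.{q, k, u, v, w} L} {B : FA.{q, k, u', v', w'} L}
    (F : Hom A B) : Prop :=
  ∃ K : Hom B A, TwoIsomorphic (F.comp K) (Hom.id A) ∧ TwoIsomorphic (K.comp F) (Hom.id B)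

end FA

/-! ### Structures -/

section

variable {C : Type u} [Category.{v} C] [CartesianMonoidalCategory C] {S : Type s} (obj : S → C)

/-- The product `⟦Γ⟧ = ⟦σ₁⟧ × ⋯ × ⟦σₙ⟧`, bracketed to the left; it is `1` for `n = 0` and `⟦σ₁⟧`
for `n = 1`. -/
def ctxObj : List S → C
  | [] => 𝟙_ C
  | [σ] => obj σ
  | σ :: τ :: Γ => ctxObj (τ :: Γ) ⊗ obj σ

/-- The projections of `⟦Γ⟧`. -/
def ctxProj : {Γ : List S} → {σ : S} → Var Γ σ → (ctxObj obj Γ ⟶ obj σ)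
  | [_], _, .zero => 𝟙 _
  | _ :: τ :: Γ, _, .zero => snd (ctxObj obj (τ :: Γ)) _
  | _ :: τ :: Γ, _, .succ x => fst (ctxObj obj (τ :: Γ)) _ ≫ ctxProj x

/-- The morphism into `⟦Γ⟧` with given components. -/
def ctxLift {X : C} : (Γ : List S) → (∀ σ, Var Γ σ → (X ⟶ obj σ)) → (X ⟶ ctxObj obj Γ)
  | [], _ => toUnit X
  | [_], h => h _ .zero
  | _ :: τ :: Γ, h => lift (ctxLift (τ :: Γ) (fun _ x => h _ x.succ)) (h _ .zero)

theorem ctxLift_proj {X : C} : (Γ : List S) → (h : ∀ σ, Var Γ σ → (X ⟶ obj σ)) →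
    ∀ {σ} (x : Var Γ σ), ctxLift obj Γ h ≫ ctxProj obj x = h σ x
  | [_], _, _, .zero => Category.comp_id _
  | _ :: τ :: Γ, _, _, .zero => lift_snd _ _
  | _ :: τ :: Γ, h, _, .succ x =>
    (lift_fst_assoc _ _ _).trans (ctxLift_proj (τ :: Γ) (fun _ x => h _ x.succ) x)

theorem ctx_hom_ext {X : C} : (Γ : List S) → (g h : X ⟶ ctxObj obj Γ) →
    (∀ σ (x : Var Γ σ), g ≫ ctxProj obj x = h ≫ ctxProj obj x) → g = h
  | [], _, _, _ => toUnit_unique _ _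
  | [σ], g, h, H =>
    (Category.comp_id g).symm.trans ((H σ .zero).trans (Category.comp_id h))
  | σ :: τ :: Γ, g, h, H => by
    refine CartesianMonoidalCategory.hom_ext _ _ ?_ (H σ .zero)
    refine ctx_hom_ext (τ :: Γ) _ _ (fun ρ x => ?_)
    exact (Category.assoc _ _ _).trans ((H ρ x.succ).trans (Category.assoc _ _ _).symm)

theorem comp_ctxLift {X Y : C} (g : X ⟶ Y) (Γ : List S) (h : ∀ σ, Var Γ σ → (Y ⟶ obj σ)) :
    g ≫ ctxLift obj Γ h = ctxLift obj Γ (fun σ x => g ≫ h σ x) := by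
  refine ctx_hom_ext obj Γ _ _ (fun σ x => ?_)
  rw [Category.assoc, ctxLift_proj, ctxLift_proj]

theorem ctxLift_ctxProj (Γ : List S) : ctxLift obj Γ (fun _ x => ctxProj obj x) = 𝟙 _ := by
  refine ctx_hom_ext obj Γ _ _ (fun σ x => ?_)
  rw [ctxLift_proj, Category.id_comp]

/-- Components of a morphism into the product `⟦Γ⟧ × ⟦Γ'⟧`, indexed by the variables of `Γ, Γ'`. -/
def appendHom {X : C} {Γ : List S} : (Γ' : List S) → (X ⟶ ctxObj obj Γ) →
    (∀ σ, Var Γ' σ → (X ⟶ obj σ)) → ∀ σ, Var (Γ' ++ Γ) σ → (X ⟶ obj σ)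
  | [], g, _, _, x => g ≫ ctxProj obj x
  | _ :: _, _, h, _, .zero => h _ .zero
  | _ :: Γ', g, h, _, .succ x => appendHom Γ' g (fun _ x => h _ x.succ) _ x

/-- The change-in-product isomorphism `⟦Γ⟧ × ⟦Γ'⟧ ⟶ ⟦Γ, Γ'⟧`. -/
def ctxAppend (Γ Γ' : List S) : ctxObj obj Γ ⊗ ctxObj obj Γ' ⟶ ctxObj obj (Γ' ++ Γ) :=
  ctxLift obj (Γ' ++ Γ) (appendHom obj Γ' (fst _ _) (fun _ x => snd _ _ ≫ ctxProj obj x))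

end

/-- An `Sg`-structure in a prop-category of `FA`. -/
structure Structure {L : Language.{q, k}} (Sg : Signature.{s, f, r})
    (A : FA.{q, k, u, v, w} L) where
  obj : Sg.Srt → A.C
  fn {Γ : List Sg.Srt} {τ : Sg.Srt} (h : Sg.Fn Γ τ) : ctxObj obj Γ ⟶ obj τ
  rel {Γ : List Sg.Srt} (R : Sg.Rel Γ) : Pr A.P (ctxObj obj Γ)

namespace Structure

variable {L : Language.{q, k}} {Sg : Signature.{s, f, r}} {A : FA.{q, k, u, v, w} L}
  (S : Structure Sg A)

/-- The object `⟦Γ⟧`. -/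
abbrev ctx (Γ : List Sg.Srt) : A.C := ctxObj S.obj Γ

/-- The interpretation `⟦M : τ [Γ]⟧` of a term-in-context. -/
def term {Γ : List Sg.Srt} {τ : Sg.Srt} : Term Sg Γ τ → (S.ctx Γ ⟶ S.obj τ)
  | .var x => ctxProj S.obj x
  | .app (Δ := Δ) h M => ctxLift S.obj Δ (fun σ x => term (M σ x)) ≫ S.fn h

/-- The interpretation `⟨⟦M₁⟧, …, ⟦Mₙ⟧⟩` of a list of terms-in-context. -/
def subst {Δ Γ : List Sg.Srt} (γ : Subst Sg Δ Γ) : S.ctx Δ ⟶ S.ctx Γ :=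
  ctxLift S.obj Γ (fun σ x => S.term (γ σ x))

/-- The change-in-product isomorphism `⟦Γ⟧ × ⟦σ⟧ ⟶ ⟦Γ, x : σ⟧`. -/
def ext (Γ : List Sg.Srt) (σ : Sg.Srt) : S.ctx Γ ⊗ S.obj σ ⟶ S.ctx (σ :: Γ) :=
  ctxAppend S.obj Γ [σ]

/-- The interpretation `⟦φ [Γ]⟧` of a formula-in-context. -/
def fml {Γ : List Sg.Srt} : Formula L Sg Γ → Pr A.P (S.ctx Γ)
  | .rel R M => pb A.P (S.subst M) (S.rel R)
  | .eq M N => pb A.P (CartesianMonoidalCategory.lift (S.term M) (S.term N)) (A.Eq (S.obj _))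
  | .conn o φ => A.conn o _ (fun i => fml (φ i))
  | .quant (Γ := Γ) Ω σ φ => A.quant Ω (S.ctx Γ) (S.obj σ) (pb A.P (S.ext Γ σ) (fml φ))

/-- Satisfaction of assertions. -/
def Sat : Assertion L Sg → Prop
  | .eqn M N => S.term M = S.term N
  | .seq Φ ψ => A.tensorList _ (Φ.map S.fml) ≤ S.fml ψ

/-- The theory `Th(S)` of a structure. -/
def Th : Theory L Sg := {a | S.Sat a}

/-! ### The theory of a structure is closed under the rules -/

theorem term_subst {Δ Γ : List Sg.Srt} (γ : Subst Sg Δ Γ) {τ : Sg.Srt} (M : Term Sg Γ τ) :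
    S.term (M.subst γ) = S.subst γ ≫ S.term M := by
  induction M with
  | var x => exact (ctxLift_proj S.obj Γ (fun σ x => S.term (γ σ x)) x).symm
  | app h M ih =>
    simp only [Term.subst, term, ← Category.assoc, comp_ctxLift, ih]

theorem subst_comp {Δ Γ Θ : List Sg.Srt} (γ : Subst Sg Δ Γ) (δ : Subst Sg Γ Θ) :
    S.subst (γ.comp δ) = S.subst γ ≫ S.subst δ := by
  simp only [subst, Subst.comp, term_subst, comp_ctxLift]

theorem subst_ids (Γ : List Sg.Srt) : S.subst (.ids Γ) = 𝟙 _ := ctxLift_ctxProj S.obj Γ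

theorem subst_proj {Δ Γ : List Sg.Srt} (γ : Subst Sg Δ Γ) {σ : Sg.Srt} (x : Var Γ σ) :
    S.subst γ ≫ ctxProj S.obj x = S.term (γ σ x) := ctxLift_proj S.obj Γ _ x

theorem ext_zero (Γ : List Sg.Srt) (σ : Sg.Srt) :
    S.ext Γ σ ≫ ctxProj S.obj (.zero : Var (σ :: Γ) σ) = snd _ _ :=
  (ctxLift_proj S.obj (σ :: Γ) _ _).trans (Category.comp_id _)

theorem ext_succ (Γ : List Sg.Srt) (σ : Sg.Srt) {τ : Sg.Srt} (x : Var Γ τ) :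
    S.ext Γ σ ≫ ctxProj S.obj (x.succ : Var (σ :: Γ) τ) = fst _ _ ≫ ctxProj S.obj x :=
  ctxLift_proj S.obj (σ :: Γ) _ _

theorem ext_wk (Γ : List Sg.Srt) (σ : Sg.Srt) :
    S.ext Γ σ ≫ S.subst (.wk Γ σ) = fst _ _ := by
  refine ctx_hom_ext S.obj Γ _ _ (fun τ x => ?_)
  rw [Category.assoc, subst_proj]
  exact S.ext_succ Γ σ x

theorem ext_lift {Δ Γ : List Sg.Srt} (γ : Subst Sg Δ Γ) (σ : Sg.Srt) :
    S.ext Δ σ ≫ S.subst (γ.lift σ) = (S.subst γ ▷ S.obj σ) ≫ S.ext Γ σ := by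
  refine ctx_hom_ext S.obj (σ :: Γ) _ _ (fun τ x => ?_)
  rw [Category.assoc, Category.assoc, subst_proj]
  cases x with
  | zero => rw [ext_zero, whiskerRight_snd]; exact S.ext_zero Δ σ
  | succ x =>
    rw [ext_succ, whiskerRight_fst_assoc, subst_proj]
    change S.ext Δ σ ≫ S.term ((γ τ x).subst (.wk Δ σ)) = _
    rw [term_subst, ← Category.assoc, ext_wk]

theorem fml_subst {Γ : List Sg.Srt} (φ : Formula L Sg Γ) :
    ∀ {Δ : List Sg.Srt} (γ : Subst Sg Δ Γ), S.fml (φ.subst γ) = pb A.P (S.subst γ) (S.fml φ) := by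
  induction φ with
  | rel R M => intro Δ γ; simp only [Formula.subst, fml, subst_comp, pb_comp]
  | eq M N => intro Δ γ; simp only [Formula.subst, fml, term_subst, ← pb_comp, comp_lift]
  | conn o φ ih => intro Δ γ; simp only [Formula.subst, fml, ih, A.pb_conn]
  | quant Ω σ φ ih =>
    intro Δ γ; simp only [Formula.subst, fml, ih, A.pb_quant, ← pb_comp, ext_lift]

theorem fml_e {Γ : List Sg.Srt} : S.fml (.e : Formula L Sg Γ) = A.e _ := by
  simp only [Formula.e, fml]; congr 1; funext i; exact i.elim0

theorem fml_tensor {Γ : List Sg.Srt} (φ ψ : Formula L Sg Γ) :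
    S.fml (φ.tensor ψ) = A.tensor _ (S.fml φ) (S.fml ψ) := by
  simp only [Formula.tensor, fml]; congr 1; funext i; fin_cases i <;> rfl

theorem term_insert {Ξ Γ : List Sg.Srt} {σ : Sg.Srt} {M M' : Term Sg Ξ σ}
    (h : S.term M = S.term M') : (Γ' : List Sg.Srt) → (γ : Subst Sg Ξ (Γ' ++ Γ)) →
    ∀ τ (x : Var (Γ' ++ σ :: Γ) τ), S.term (Subst.insert Γ' γ M τ x) =
      S.term (Subst.insert Γ' γ M' τ x)
  | [], _, _, .zero => h
  | [], _, _, .succ _ => rfl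
  | _ :: _, _, _, .zero => rfl
  | _ :: Γ', _, _, .succ x => term_insert h Γ' _ _ x

theorem subst_single {Γ Γ' : List Sg.Srt} {σ : Sg.Srt} {M M' : Term Sg (Γ' ++ Γ) σ}
    (h : S.term M = S.term M') : S.subst (.single Γ' M) = S.subst (.single Γ' M') := by
  simp only [subst, Subst.single, S.term_insert h]

theorem seq_single {Γ : List Sg.Srt} {φ ψ : Formula L Sg Γ} :
    Assertion.seq [φ] ψ ∈ S.Th ↔ S.fml φ ≤ S.fml ψ := by
  change A.tensorList _ [S.fml φ] ≤ _ ↔ _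
  rw [A.tensorList_singleton]

theorem map_fml_subst {Δ Γ : List Sg.Srt} (Φ : List (Formula L Sg Γ)) (γ : Subst Sg Δ Γ) :
    A.tensorList _ ((Φ.map fun φ => φ.subst γ).map S.fml) =
      pb A.P (S.subst γ) (A.tensorList _ (Φ.map S.fml)) := by
  rw [A.pb_tensorList, List.map_map, List.map_map]
  congr 2
  funext φ
  exact S.fml_subst φ γ

theorem th_isLm : S.Th.IsLm where
  eqn_refl _ := rfl
  eqn_symm h := Eq.symm h
  eqn_trans h h' := Eq.trans h h'
  eqn_sub {Γ Γ' Δ σ τ} ρ _ {M M' N N'} h h' := by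
    change S.term _ = S.term _
    change S.term M = S.term M' at h
    change S.term N = S.term N' at h'
    rw [S.term_subst _ N, S.term_subst _ N', h',
      S.subst_single (M := M.subst _) (M' := M'.subst _) (by rw [term_subst, term_subst, h])]
  ax φ := S.seq_single.2 le_rfl
  cut h h' := S.seq_single.2 ((S.seq_single.1 h).trans (S.seq_single.1 h'))
  cwk {Γ} σ {Φ ψ} h := by
    change A.tensorList _ _ ≤ _
    rw [map_fml_subst, fml_subst]
    exact pb_mono A.P _ h
  sub {Γ Γ' Δ σ} ρ _ {M M' Φ ψ} h h' := by
    change A.tensorList _ _ ≤ _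
    change S.term M = S.term M' at h
    rw [map_fml_subst, fml_subst,
      S.subst_single (M := M.subst _) (M' := M'.subst _) (by rw [term_subst, term_subst, h])]
    exact pb_mono A.P _ h'
  quant_cong {Γ} Ω σ {φ ψ} h h' := by
    rw [seq_single] at *
    simp only [fml, le_antisymm h h']
    exact le_rfl
  conn_cong {Γ n} o {φ ψ} h h' := by
    simp only [seq_single] at *
    have : (fun i => S.fml (φ i)) = fun i => S.fml (ψ i) :=
      funext fun i => le_antisymm (h i) (h' i)
    simp only [fml, this]
    exact le_rfl
  tensor_ref {Γ Φ Ψ α β θ} := by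
    change A.tensorList _ _ ≤ _ ↔ A.tensorList _ _ ≤ _
    rw [List.map_append, List.map_append, A.tensorList_append, A.tensorList_append]
    have : A.tensorList _ ((α :: β :: Ψ).map S.fml) =
        A.tensorList _ ((α.tensor β :: Ψ).map S.fml) := by
      rw [List.map_cons, List.map_cons, List.map_cons, fml_tensor]
      exact (A.tensor_assoc _ _ _ _).symm
    rw [this]
  e_ref {Γ Φ Ψ θ} := by
    change A.tensorList _ _ ≤ _ ↔ A.tensorList _ _ ≤ _
    rw [List.map_append, List.map_append, A.tensorList_append, A.tensorList_append]
    have : A.tensorList _ ((.e :: Ψ).map S.fml) = A.tensorList _ (Ψ.map S.fml) := by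
      rw [List.map_cons, fml_e]
      exact A.e_tensor _ _
    rw [this]

end Structure

/-! ### The classifying prop-category of a theory -/

section

variable {L : Language.{q, k}} {Sg : Signature.{s, f, r}} {T : Theory L Sg}

namespace Subst

theorem comp_right_append {Δ Γ : List Sg.Srt} (Γ' : List Sg.Srt) (γ : Subst Sg Δ Γ)
    (δ : Subst Sg Δ Γ') : (append Γ' γ δ).comp (ofRen fun _ x => x.right Γ') = γ := by
  funext σ x; exact append_right Γ' γ δ x

theorem comp_left_append {Δ Γ : List Sg.Srt} (Γ' : List Sg.Srt) (γ : Subst Sg Δ Γ)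
    (δ : Subst Sg Δ Γ') : (append Γ' γ δ).comp (ofRen fun _ x => x.left) = δ := by
  funext σ x; exact append_left Γ' γ δ x

/-- The substitution `γ × Γ'`. -/
def whisker {Δ Γ : List Sg.Srt} (Γ' : List Sg.Srt) (γ : Subst Sg Δ Γ) :
    Subst Sg (Γ' ++ Δ) (Γ' ++ Γ) :=
  append Γ' (comp (ofRen fun _ x => x.right Γ') γ) (ofRen fun _ x => x.left)

theorem whisker_cons {Δ Γ : List Sg.Srt} (σ : Sg.Srt) (Γ' : List Sg.Srt) (γ : Subst Sg Δ Γ) :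
    whisker (σ :: Γ') γ = (whisker Γ' γ).lift σ := by
  rw [whisker, append, lift, whisker, comp_append, ← comp_assoc]; rfl

/-- The associativity isomorphism of concatenation, as a substitution. -/
def assoc (b c : List Sg.Srt) : (d : List Sg.Srt) → Subst Sg ((d ++ c) ++ b) (d ++ (c ++ b))
  | [] => ids _
  | σ :: d => (assoc b c d).lift σ

theorem assoc_right_right (b c : List Sg.Srt) : (d : List Sg.Srt) → ∀ {σ : Sg.Srt} (x : Var b σ),
    assoc b c d σ ((x.right c).right d) = .var (x.right (d ++ c))
  | [], _, _ => rfl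
  | _ :: d, _, x => congrArg (Term.subst (wk _ _)) (assoc_right_right b c d x)

theorem assoc_right_left (b c : List Sg.Srt) : (d : List Sg.Srt) → ∀ {σ : Sg.Srt} (x : Var c σ),
    assoc b c d σ ((x.left : Var (c ++ b) σ).right d) = .var (x.right d).left
  | [], _, _ => rfl
  | _ :: d, _, x => congrArg (Term.subst (wk _ _)) (assoc_right_left b c d x)

theorem assoc_left (b c : List Sg.Srt) : (d : List Sg.Srt) → ∀ {σ : Sg.Srt} (x : Var d σ),
    assoc b c d σ x.left = .var (x.left : Var (d ++ c) σ).left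
  | _ :: _, _, .zero => rfl
  | _ :: d, _, .succ x => congrArg (Term.subst (wk _ _)) (assoc_left b c d x)

end Subst

theorem Formula.quants_subst {Δ Γ : List Sg.Srt} (Ω : L.Quant) (γ : Subst Sg Δ Γ) :
    (Γ' : List Sg.Srt) → (φ : Formula L Sg (Γ' ++ Γ)) →
    (quants Ω Γ' φ).subst γ = quants Ω Γ' (φ.subst (γ.whisker Γ'))
  | [], φ => congrArg φ.subst (Subst.ids_comp γ).symm
  | σ :: Γ', φ => by
    rw [quants, quants_subst Ω γ Γ', Subst.whisker_cons]; rfl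

theorem Formula.quants_append {b : List Sg.Srt} (c : List Sg.Srt) (Ω : L.Quant) :
    (d : List Sg.Srt) → (φ : Formula L Sg (d ++ (c ++ b))) →
    quants Ω (d ++ c) (φ.subst (.assoc b c d)) = quants Ω c (quants Ω d φ)
  | [], φ => congrArg (quants Ω c) φ.subst_ids
  | σ :: d, φ => quants_append c Ω d (quant Ω σ φ)

namespace Theory.IsLm

open Assertion

theorem subEq_refl (hT : T.IsLm) {Δ Γ : List Sg.Srt} (γ : Subst Sg Δ Γ) : T.SubEq γ γ :=
  fun _ _ => hT.eqn_refl _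

theorem subEq_comp (hT : T.IsLm) {Δ Γ Θ : List Sg.Srt} {γ γ' : Subst Sg Δ Γ}
    {δ δ' : Subst Sg Γ Θ} (h : T.SubEq γ γ') (h' : T.SubEq δ δ') :
    T.SubEq (γ.comp δ) (γ'.comp δ') :=
  fun σ x => hT.eqn_subst h (h' σ x)

theorem subEq_append (hT : T.IsLm) {Δ Γ : List Sg.Srt} {γ γ' : Subst Sg Δ Γ}
    (h : T.SubEq γ γ') : (Γ' : List Sg.Srt) → {δ δ' : Subst Sg Δ Γ'} → T.SubEq δ δ' →
    T.SubEq (.append Γ' γ δ) (.append Γ' γ' δ')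
  | [], _, _, _ => h
  | _ :: _, _, _, h' => fun
    | _, .zero => h' _ .zero
    | _, .succ x => hT.subEq_append h _ (fun _ y => h' _ y.succ) _ x

/-- Lists of terms up to provable equality of the entries. -/
def homSetoid (hT : T.IsLm) (Δ Γ : List Sg.Srt) : Setoid (Subst Sg Δ Γ) where
  r := T.SubEq
  iseqv := ⟨fun γ => hT.subEq_refl γ, fun h σ x => hT.eqn_symm (h σ x),
    fun h h' σ x => hT.eqn_trans (h σ x) (h' σ x)⟩

/-- Formulas in the context `Γ` up to `φ ∼ ψ` iff `φ ⊢ ψ` and `ψ ⊢ φ` are in `T`. -/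
def fmlSetoid (hT : T.IsLm) (Γ : List Sg.Srt) : Setoid (Formula L Sg Γ) where
  r φ ψ := seq [φ] ψ ∈ T ∧ seq [ψ] φ ∈ T
  iseqv := ⟨fun φ => ⟨hT.ax φ, hT.ax φ⟩, fun h => ⟨h.2, h.1⟩,
    fun h h' => ⟨hT.cut h.1 h'.1, hT.cut h'.2 h.2⟩⟩

/-- The set `P_T(Γ)`. -/
def Fml (hT : T.IsLm) (Γ : List Sg.Srt) : Type (max q k s f r) := Quotient (hT.fmlSetoid Γ)

/-- The class of a formula. -/
def cls (hT : T.IsLm) {Γ : List Sg.Srt} (φ : Formula L Sg Γ) : hT.Fml Γ :=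
  Quotient.mk (hT.fmlSetoid Γ) φ

theorem cls_eq (hT : T.IsLm) {Γ : List Sg.Srt} {φ ψ : Formula L Sg Γ} (h : seq [φ] ψ ∈ T)
    (h' : seq [ψ] φ ∈ T) : hT.cls φ = hT.cls ψ :=
  Quotient.sound (s := hT.fmlSetoid Γ) ⟨h, h'⟩

theorem cls_exact (hT : T.IsLm) {Γ : List Sg.Srt} {φ ψ : Formula L Sg Γ}
    (h : hT.cls φ = hT.cls ψ) : seq [φ] ψ ∈ T ∧ seq [ψ] φ ∈ T :=
  Quotient.exact (s := hT.fmlSetoid Γ) h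

theorem cls_surjective (hT : T.IsLm) {Γ : List Sg.Srt} (x : hT.Fml Γ) : ∃ φ, hT.cls φ = x :=
  Quotient.exists_rep x

instance (hT : T.IsLm) (Γ : List Sg.Srt) : PartialOrder (hT.Fml Γ) where
  le x y := Quotient.liftOn₂ x y (fun φ ψ => seq [φ] ψ ∈ T) (fun _ _ _ _ h h' =>
    propext ⟨fun H => hT.cut (hT.cut h.2 H) h'.1, fun H => hT.cut (hT.cut h.1 H) h'.2⟩)
  le_refl x := by
    obtain ⟨φ, rfl⟩ := hT.cls_surjective x
    exact hT.ax φ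
  le_trans x y z := by
    obtain ⟨φ, rfl⟩ := hT.cls_surjective x
    obtain ⟨ψ, rfl⟩ := hT.cls_surjective y
    obtain ⟨θ, rfl⟩ := hT.cls_surjective z
    exact fun h h' => hT.cut h h'
  le_antisymm x y := by
    obtain ⟨φ, rfl⟩ := hT.cls_surjective x
    obtain ⟨ψ, rfl⟩ := hT.cls_surjective y
    exact fun h h' => hT.cls_eq h h'

/-- The objects of `C_T`: contexts, up to renaming of their variables. -/
structure Ctx (hT : T.IsLm) : Type s where
  of ::
  list : List Sg.Srt

instance (hT : T.IsLm) : Category.{max s f} hT.Ctx where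
  Hom Δ Γ := Quotient (hT.homSetoid Δ.list Γ.list)
  id Γ := Quotient.mk _ (.ids Γ.list)
  comp {Δ Γ Θ} := Quotient.map₂ (fun (γ : Subst Sg Δ.list Γ.list)
    (δ : Subst Sg Γ.list Θ.list) => γ.comp δ)
    (fun _ _ h _ _ h' => hT.subEq_comp h h')
  id_comp := by
    rintro Δ Γ ⟨γ⟩
    exact congrArg (Quotient.mk _) (Subst.ids_comp γ)
  comp_id := by
    rintro Δ Γ ⟨γ⟩
    rfl
  assoc := by
    rintro _ _ _ _ ⟨γ⟩ ⟨δ⟩ ⟨ε⟩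
    exact congrArg (Quotient.mk _) (Subst.comp_assoc γ δ ε)

/-- The morphism `Δ ⟶ Γ` of `C_T` given by a list of terms. -/
def hom (hT : T.IsLm) {Δ Γ : List Sg.Srt} (γ : Subst Sg Δ Γ) :
    (⟨Δ⟩ : hT.Ctx) ⟶ ⟨Γ⟩ :=
  Quotient.mk (hT.homSetoid Δ Γ) γ

theorem hom_eq (hT : T.IsLm) {Δ Γ : List Sg.Srt} {γ δ : Subst Sg Δ Γ} (h : T.SubEq γ δ) :
    hT.hom γ = hT.hom δ := Quotient.sound (s := hT.homSetoid Δ Γ) h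

theorem hom_exact (hT : T.IsLm) {Δ Γ : List Sg.Srt} {γ δ : Subst Sg Δ Γ}
    (h : hT.hom γ = hT.hom δ) : T.SubEq γ δ := Quotient.exact (s := hT.homSetoid Δ Γ) h

theorem hom_surjective (hT : T.IsLm) {Δ Γ : hT.Ctx} (g : Δ ⟶ Γ) :
    ∃ γ : Subst Sg Δ.list Γ.list, hT.hom γ = g := Quotient.exists_rep g

theorem hom_comp (hT : T.IsLm) {Δ Γ Θ : List Sg.Srt} (γ : Subst Sg Δ Γ) (δ : Subst Sg Γ Θ) :
    hT.hom γ ≫ hT.hom δ = hT.hom (γ.comp δ) := rfl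

theorem hom_ids (hT : T.IsLm) (Γ : List Sg.Srt) : hT.hom (.ids Γ) = 𝟙 (⟨Γ⟩ : hT.Ctx) := rfl

/-- The designated products of `C_T`: the empty context is terminal and `Γ × Γ'` is `Γ, Γ'`. -/
instance (hT : T.IsLm) : CartesianMonoidalCategory hT.Ctx :=
  .ofChosenFiniteProducts
    ⟨Limits.asEmptyCone (⟨[]⟩ : hT.Ctx),
      Limits.IsTerminal.ofUniqueHom (fun _ => hT.hom (fun σ (x : Var [] σ) => nomatch x)) (by
        intro Δ g
        obtain ⟨γ, rfl⟩ := hT.hom_surjective g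
        exact hT.hom_eq (fun σ (x : Var [] σ) => nomatch x))⟩
    (fun Γ Γ' =>
      ⟨Limits.BinaryFan.mk (P := (⟨Γ'.list ++ Γ.list⟩ : hT.Ctx))
          (hT.hom (.ofRen fun _ x => x.right Γ'.list)) (hT.hom (.ofRen fun _ x => x.left)),
        Limits.BinaryFan.isLimitMk
          (fun t => Quotient.map₂ (.append Γ'.list) (fun _ _ h _ _ h' => hT.subEq_append h Γ'.list h')
            t.fst t.snd)
          (fun t => by
            obtain ⟨γ, hγ⟩ := hT.hom_surjective t.fst
            obtain ⟨δ, hδ⟩ := hT.hom_surjective t.snd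
            rw [← hγ, ← hδ]
            exact congrArg hT.hom (Subst.comp_right_append _ γ δ))
          (fun t => by
            obtain ⟨γ, hγ⟩ := hT.hom_surjective t.fst
            obtain ⟨δ, hδ⟩ := hT.hom_surjective t.snd
            rw [← hγ, ← hδ]
            exact congrArg hT.hom (Subst.comp_left_append _ γ δ))
          (fun t m h h' => by
            obtain ⟨μ, rfl⟩ := hT.hom_surjective m
            rw [← h, ← h']
            exact congrArg hT.hom (Subst.append_eta Γ'.list μ).symm)⟩)

theorem fst_eq (hT : T.IsLm) (Γ Γ' : List Sg.Srt) :
    fst (⟨Γ⟩ : hT.Ctx) ⟨Γ'⟩ = hT.hom (.ofRen fun _ x => x.right Γ') := rfl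

theorem snd_eq (hT : T.IsLm) (Γ Γ' : List Sg.Srt) :
    snd (⟨Γ⟩ : hT.Ctx) ⟨Γ'⟩ = hT.hom (.ofRen fun _ x => x.left) := rfl

theorem lift_eq (hT : T.IsLm) {Δ Γ Γ' : List Sg.Srt} (γ : Subst Sg Δ Γ) (δ : Subst Sg Δ Γ') :
    CartesianMonoidalCategory.lift (hT.hom γ) (hT.hom δ) = hT.hom (.append Γ' γ δ) := by
  apply CartesianMonoidalCategory.hom_ext
  · rw [lift_fst]; exact congrArg hT.hom (Subst.comp_right_append Γ' γ δ).symm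
  · rw [lift_snd]; exact congrArg hT.hom (Subst.comp_left_append Γ' γ δ).symm

theorem whisker_eq (hT : T.IsLm) {Δ Γ : List Sg.Srt} (γ : Subst Sg Δ Γ) (Γ' : List Sg.Srt) :
    hT.hom γ ▷ (⟨Γ'⟩ : hT.Ctx) = hT.hom (γ.whisker Γ') := by
  apply CartesianMonoidalCategory.hom_ext
  · rw [whiskerRight_fst]; exact congrArg hT.hom (Subst.comp_right_append Γ' _ _).symm
  · rw [whiskerRight_snd]; exact congrArg hT.hom (Subst.comp_left_append Γ' _ _).symm

theorem assoc_eq (hT : T.IsLm) (b c d : List Sg.Srt) :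
    (α_ (⟨b⟩ : hT.Ctx) ⟨c⟩ ⟨d⟩).inv = hT.hom (.assoc b c d) := by
  apply CartesianMonoidalCategory.hom_ext
  · apply CartesianMonoidalCategory.hom_ext
    · rw [Category.assoc, Category.assoc, associator_inv_fst_fst]
      refine congrArg hT.hom ?_
      funext σ x; exact (Subst.assoc_right_right b c d x).symm
    · rw [Category.assoc, Category.assoc, associator_inv_fst_snd]
      refine congrArg hT.hom ?_
      funext σ x; exact (Subst.assoc_right_left b c d x).symm
  · rw [associator_inv_snd]
    refine congrArg hT.hom ?_
    funext σ x; exact (Subst.assoc_left b c d x).symm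

/-- The functor `P_T`, acting on morphisms by simultaneous substitution. -/
def pred (hT : T.IsLm) : hT.Ctxᵒᵖ ⥤ PartOrd.{max q k s f r} where
  obj Γ := PartOrd.of (hT.Fml Γ.unop.list)
  map {Γ Δ} g := PartOrd.ofHom
    { toFun := Quotient.map₂ (fun (γ : Subst Sg Δ.unop.list Γ.unop.list)
          (φ : Formula L Sg Γ.unop.list) =>
          φ.subst γ) (fun _ _ (h : T.SubEq _ _) _ _ h' => ⟨hT.seq_subst h h'.1,
            hT.seq_subst (fun σ x => hT.eqn_symm (h σ x)) h'.2⟩) g.unop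
      monotone' := by
        obtain ⟨γ, hγ⟩ := hT.hom_surjective g.unop
        rw [← hγ]
        intro x y
        obtain ⟨φ, rfl⟩ := hT.cls_surjective x
        obtain ⟨ψ, rfl⟩ := hT.cls_surjective y
        exact fun h => hT.seq_subst (hT.subEq_refl γ) h }
  map_id Γ := by
    ext x
    obtain ⟨φ, rfl⟩ := hT.cls_surjective x
    exact congrArg hT.cls φ.subst_ids
  map_comp {Γ Δ Θ} g h := by
    ext x
    obtain ⟨φ, rfl⟩ := hT.cls_surjective x
    obtain ⟨γ, hγ⟩ := hT.hom_surjective g.unop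
    obtain ⟨δ, hδ⟩ := hT.hom_surjective h.unop
    obtain rfl : (hT.hom γ).op = g := congrArg Quiver.Hom.op hγ
    obtain rfl : (hT.hom δ).op = h := congrArg Quiver.Hom.op hδ
    exact congrArg hT.cls (φ.subst_subst δ γ).symm

theorem pb_cls (hT : T.IsLm) {Δ Γ : List Sg.Srt} (γ : Subst Sg Δ Γ) (φ : Formula L Sg Γ) :
    pb hT.pred (hT.hom γ) (hT.cls φ) = hT.cls (φ.subst γ) := rfl

/-- The connectives of `P_T(Γ)`. -/
noncomputable def conn (hT : T.IsLm) {n : ℕ} (o : L.Conn n) (Γ : List Sg.Srt)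
    (x : Fin n → hT.Fml Γ) : hT.Fml Γ :=
  hT.cls (.conn o (fun i => (x i).out))

theorem conn_cls (hT : T.IsLm) {n : ℕ} (o : L.Conn n) {Γ : List Sg.Srt}
    (φ : Fin n → Formula L Sg Γ) :
    hT.conn o Γ (fun i => hT.cls (φ i)) = hT.cls (.conn o φ) := by
  have h i := hT.cls_exact (φ := (hT.cls (φ i)).out) (ψ := φ i) (Quotient.out_eq _)
  exact hT.cls_eq (hT.conn_cong o (fun i => (h i).1) (fun i => (h i).2))
    (hT.conn_cong o (fun i => (h i).2) (fun i => (h i).1))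

theorem tensor_cls (hT : T.IsLm) {Γ : List Sg.Srt} (φ ψ : Formula L Sg Γ) :
    hT.conn L.tensor Γ ![hT.cls φ, hT.cls ψ] = hT.cls (φ.tensor ψ) := by
  rw [Formula.tensor, ← conn_cls]; congr 1; funext i; fin_cases i <;> rfl

theorem e_cls (hT : T.IsLm) (Γ : List Sg.Srt) :
    hT.conn L.e Γ ![] = hT.cls .e := by
  rw [Formula.e, ← conn_cls]; congr 1; funext i; exact i.elim0

theorem cls_tensor_assoc (hT : T.IsLm) {Γ : List Sg.Srt} (α β γ : Formula L Sg Γ) :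
    hT.cls ((α.tensor β).tensor γ) = hT.cls (α.tensor (β.tensor γ)) := by
  have key (θ : Formula L Sg Γ) :
      seq [(α.tensor β).tensor γ] θ ∈ T ↔ seq [α.tensor (β.tensor γ)] θ ∈ T :=
    ((hT.tensor_ref (Φ := []) (Ψ := [])).symm.trans
      (hT.tensor_ref (Φ := []) (Ψ := [γ])).symm).trans
    ((hT.tensor_ref (Φ := [α]) (Ψ := [])).trans (hT.tensor_ref (Φ := []) (Ψ := [])))
  exact hT.cls_eq ((key _).2 (hT.ax _)) ((key _).1 (hT.ax _))

theorem cls_e_tensor (hT : T.IsLm) {Γ : List Sg.Srt} (φ : Formula L Sg Γ) :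
    hT.cls (Formula.tensor .e φ) = hT.cls φ := by
  have key (θ : Formula L Sg Γ) : seq [Formula.tensor .e φ] θ ∈ T ↔ seq [φ] θ ∈ T :=
    (hT.tensor_ref (Φ := []) (Ψ := [])).symm.trans (hT.e_ref (Φ := []) (Ψ := [φ]))
  exact hT.cls_eq ((key _).2 (hT.ax _)) ((key _).1 (hT.ax _))

theorem cls_tensor_e (hT : T.IsLm) {Γ : List Sg.Srt} (φ : Formula L Sg Γ) :
    hT.cls (φ.tensor .e) = hT.cls φ := by
  have key (θ : Formula L Sg Γ) : seq [φ.tensor .e] θ ∈ T ↔ seq [φ] θ ∈ T :=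
    (hT.tensor_ref (Φ := []) (Ψ := [])).symm.trans (hT.e_ref (Φ := [φ]) (Ψ := []))
  exact hT.cls_eq ((key _).2 (hT.ax _)) ((key _).1 (hT.ax _))

theorem cls_tensor_congr (hT : T.IsLm) {Γ : List Sg.Srt} {φ φ' ψ ψ' : Formula L Sg Γ}
    (h : hT.cls φ = hT.cls φ') (h' : hT.cls ψ = hT.cls ψ') :
    hT.cls (φ.tensor ψ) = hT.cls (φ'.tensor ψ') := by
  rw [← tensor_cls, ← tensor_cls, h, h']

theorem cls_eqs_cons (hT : T.IsLm) {Δ : List Sg.Srt} (σ : Sg.Srt) :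
    (Γ : List Sg.Srt) → (γ δ : Subst Sg Δ (σ :: Γ)) → hT.cls (.eqs (σ :: Γ) γ δ) =
    hT.cls ((Formula.eqs Γ (fun _ x => γ _ x.succ) (fun _ x => δ _ x.succ)).tensor
      (.eq (γ _ .zero) (δ _ .zero)))
  | [], _, _ => (hT.cls_e_tensor _).symm
  | _ :: _, _, _ => rfl

theorem cls_eqs_append (hT : T.IsLm) {Δ : List Sg.Srt} (Γ : List Sg.Srt) :
    (Γ' : List Sg.Srt) → (γ δ : Subst Sg Δ (Γ' ++ Γ)) → hT.cls (.eqs (Γ' ++ Γ) γ δ) =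
    hT.cls ((Formula.eqs Γ (fun _ x => γ _ (x.right Γ')) (fun _ x => δ _ (x.right Γ'))).tensor
      (Formula.eqs Γ' (fun _ x => γ _ x.left) (fun _ x => δ _ x.left)))
  | [], _, _ => (hT.cls_tensor_e _).symm
  | σ :: Γ', γ, δ => by
    refine (hT.cls_eqs_cons σ (Γ' ++ Γ) γ δ).trans ?_
    refine (hT.cls_tensor_congr (hT.cls_eqs_append Γ Γ' _ _) rfl).trans ?_
    refine (hT.cls_tensor_assoc _ _ _).trans ?_
    exact hT.cls_tensor_congr rfl
      (hT.cls_eqs_cons σ Γ' (fun _ x => γ _ x.left) (fun _ x => δ _ x.left)).symm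

theorem quants_cong (hT : T.IsLm) {Γ : List Sg.Srt} (Ω : L.Quant) :
    (Γ' : List Sg.Srt) → {φ ψ : Formula L Sg (Γ' ++ Γ)} →
    seq [φ] ψ ∈ T ∧ seq [ψ] φ ∈ T →
    seq [.quants Ω Γ' φ] (.quants Ω Γ' ψ) ∈ T ∧ seq [.quants Ω Γ' ψ] (.quants Ω Γ' φ) ∈ T
  | [], _, _, h => h
  | σ :: Γ', _, _, h =>
    hT.quants_cong Ω Γ' ⟨hT.quant_cong Ω σ h.1 h.2, hT.quant_cong Ω σ h.2 h.1⟩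

/-- The quantifiers `Ω_{Γ,Γ'}` of the classifying prop-category. -/
def quant (hT : T.IsLm) (Ω : L.Quant) (Γ Γ' : List Sg.Srt) : hT.Fml (Γ' ++ Γ) → hT.Fml Γ :=
  Quotient.map (.quants Ω Γ') (fun _ _ h => hT.quants_cong Ω Γ' h)

theorem quant_cls (hT : T.IsLm) (Ω : L.Quant) {Γ Γ' : List Sg.Srt}
    (φ : Formula L Sg (Γ' ++ Γ)) : hT.quant Ω Γ Γ' (hT.cls φ) = hT.cls (.quants Ω Γ' φ) := rfl

theorem conn_tensor_assoc (hT : T.IsLm) {Γ : List Sg.Srt} (x y z : hT.Fml Γ) :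
    hT.conn L.tensor Γ ![hT.conn L.tensor Γ ![x, y], z] =
      hT.conn L.tensor Γ ![x, hT.conn L.tensor Γ ![y, z]] := by
  obtain ⟨φ, rfl⟩ := hT.cls_surjective x
  obtain ⟨ψ, rfl⟩ := hT.cls_surjective y
  obtain ⟨θ, rfl⟩ := hT.cls_surjective z
  simp only [tensor_cls, cls_tensor_assoc]

theorem conn_e_tensor (hT : T.IsLm) {Γ : List Sg.Srt} (x : hT.Fml Γ) :
    hT.conn L.tensor Γ ![hT.conn L.e Γ ![], x] = x := by
  obtain ⟨φ, rfl⟩ := hT.cls_surjective x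
  simp only [e_cls, tensor_cls, cls_e_tensor]

theorem conn_tensor_e (hT : T.IsLm) {Γ : List Sg.Srt} (x : hT.Fml Γ) :
    hT.conn L.tensor Γ ![x, hT.conn L.e Γ ![]] = x := by
  obtain ⟨φ, rfl⟩ := hT.cls_surjective x
  simp only [e_cls, tensor_cls, cls_tensor_e]

theorem pb_eqs (hT : T.IsLm) {Δ Γ : List Sg.Srt} (γ δ : Subst Sg Δ Γ) :
    pb hT.pred (CartesianMonoidalCategory.lift (hT.hom γ) (hT.hom δ))
      (hT.cls (Γ := Γ ++ Γ) (.eqs Γ (.ofRen fun _ x => x.right Γ) (.ofRen fun _ x => x.left))) =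
      hT.cls (.eqs Γ γ δ) := by
  rw [lift_eq]
  refine congrArg hT.cls (Formula.subst_eqs _ _ _ _ |>.trans ?_)
  rw [Subst.comp_right_append, Subst.comp_left_append]

/-- The classifying prop-category `(C_T, P_T)`. -/
noncomputable def classifying (hT : T.IsLm) :
    FA.{q, k, s, max s f, max q k s f r} L where
  C := hT.Ctx
  P := hT.pred
  conn o Γ := hT.conn o Γ.list
  pb_conn {n} o {Δ Γ} g x := by
    obtain ⟨γ, rfl⟩ := hT.hom_surjective g
    choose φ hφ using fun i => hT.cls_surjective (x i)
    obtain rfl : (fun i => hT.cls (φ i)) = x := funext hφ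
    rw [conn_cls]
    exact (hT.conn_cls o fun i => (φ i).subst γ).symm
  Eq Γ := hT.cls (Γ := Γ.list ++ Γ.list)
    (.eqs Γ.list (.ofRen fun _ x => x.right Γ.list) (.ofRen fun _ x => x.left))
  quant Ω Γ Γ' := hT.quant Ω Γ.list Γ'.list
  pb_quant Ω {Δ Γ} Γ' g x := by
    obtain ⟨γ, rfl⟩ := hT.hom_surjective g
    obtain ⟨φ, rfl⟩ := hT.cls_surjective x
    rw [whisker_eq]
    exact congrArg hT.cls (Formula.quants_subst Ω γ Γ'.list φ)
  tensor_assoc _ x y z := hT.conn_tensor_assoc x y z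
  e_tensor _ x := hT.conn_e_tensor x
  tensor_e _ x := hT.conn_tensor_e x
  quant_one Ω Γ x := by
    obtain ⟨φ, rfl⟩ := hT.cls_surjective x
    exact congrArg hT.cls φ.subst_ids
  quant_prod Ω b c d x := by
    obtain ⟨φ, rfl⟩ := hT.cls_surjective x
    rw [assoc_eq]
    exact congrArg hT.cls (Formula.quants_append c.list Ω d.list φ)
  Eq_one := (hT.e_cls _).symm
  Eq_prod Γ Γ' := by
    refine (hT.cls_eqs_append Γ.list Γ'.list _ _).trans ?_
    refine (hT.tensor_cls _ _).symm.trans ?_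
    exact (congrArg₂ (fun x y => hT.conn L.tensor _ ![x, y]) (hT.pb_eqs _ _) (hT.pb_eqs _ _)).symm

end Theory.IsLm

end

/-! ### The morphism induced by a model -/

namespace Structure

variable {L : Language.{q, k}} {Sg : Signature.{s, f, r}} {A : FA.{q, k, u, v, w} L}
  (S : Structure Sg A)

theorem ctxAppend_right (Γ : List Sg.Srt) : (Γ' : List Sg.Srt) → {X : A.C} →
    (g : X ⟶ S.ctx Γ) → (h : ∀ σ, Var Γ' σ → (X ⟶ S.obj σ)) → ∀ {σ} (x : Var Γ σ),
    appendHom S.obj Γ' g h σ (x.right Γ') = g ≫ ctxProj S.obj x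
  | [], _, _, _, _, _ => rfl
  | _ :: Γ', _, g, _, _, x => ctxAppend_right Γ Γ' g _ x

theorem ctxAppend_left (Γ : List Sg.Srt) : (Γ' : List Sg.Srt) → {X : A.C} →
    (g : X ⟶ S.ctx Γ) → (h : ∀ σ, Var Γ' σ → (X ⟶ S.obj σ)) → ∀ {σ} (x : Var Γ' σ),
    appendHom S.obj Γ' g h σ x.left = h σ x
  | _ :: _, _, _, _, _, .zero => rfl
  | _ :: Γ', _, g, _, _, .succ x => ctxAppend_left Γ Γ' g _ x

theorem ctxAppend_fst (Γ Γ' : List Sg.Srt) :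
    ctxAppend S.obj Γ Γ' ≫ S.subst (.ofRen fun _ x => x.right Γ') = fst _ _ := by
  refine ctx_hom_ext S.obj Γ _ _ (fun σ x => ?_)
  rw [Category.assoc, subst_proj]
  exact (ctxLift_proj S.obj _ _ _).trans (S.ctxAppend_right Γ Γ' _ _ x)

theorem ctxAppend_snd (Γ Γ' : List Sg.Srt) :
    ctxAppend S.obj Γ Γ' ≫ S.subst (.ofRen fun _ x => x.left) = snd _ _ := by
  refine ctx_hom_ext S.obj Γ' _ _ (fun σ x => ?_)
  rw [Category.assoc, subst_proj]
  exact (ctxLift_proj S.obj _ _ _).trans (S.ctxAppend_left Γ Γ' _ _ x)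

theorem append_var (Γ : List Sg.Srt) {P : ∀ Γ' : List Sg.Srt, ∀ σ, Var (Γ' ++ Γ) σ → Prop}
    (hr : ∀ Γ' σ (x : Var Γ σ), P Γ' σ (x.right Γ'))
    (hl : ∀ Γ' σ (x : Var Γ' σ), P Γ' σ x.left)
    (Γ' : List Sg.Srt) {σ : Sg.Srt} (x : Var (Γ' ++ Γ) σ) : P Γ' σ x := by
  have : ∀ (Γ' : List Sg.Srt) {σ : Sg.Srt} (x : Var (Γ' ++ Γ) σ),
      (∃ y : Var Γ σ, x = y.right Γ') ∨ (∃ y : Var Γ' σ, x = y.left) := by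
    intro Γ'
    induction Γ' with
    | nil => exact fun x => .inl ⟨x, rfl⟩
    | cons τ Γ' ih =>
      intro σ x
      cases x with
      | zero => exact .inr ⟨.zero, rfl⟩
      | succ x =>
        rcases ih x with ⟨y, rfl⟩ | ⟨y, rfl⟩
        · exact .inl ⟨y, rfl⟩
        · exact .inr ⟨y.succ, rfl⟩
  rcases this Γ' x with ⟨y, rfl⟩ | ⟨y, rfl⟩
  · exact hr _ _ _
  · exact hl _ _ _

theorem lift_ctxAppend (Γ Γ' : List Sg.Srt) :
    CartesianMonoidalCategory.lift (S.subst (.ofRen fun _ x => x.right Γ'))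
      (S.subst (.ofRen fun _ x => x.left)) ≫ ctxAppend S.obj Γ Γ' = 𝟙 _ := by
  refine ctx_hom_ext S.obj (Γ' ++ Γ) _ _ (fun σ x => ?_)
  rw [Category.id_comp, Category.assoc, ctxAppend, ctxLift_proj]
  refine append_var Γ (P := fun Γ' σ x => CartesianMonoidalCategory.lift
    (S.subst (.ofRen fun _ x => x.right Γ')) (S.subst (.ofRen fun _ x => x.left)) ≫
      appendHom S.obj Γ' (fst (S.ctx Γ) _) (fun _ x => snd _ (S.ctx Γ') ≫ ctxProj S.obj x) σ x =
      ctxProj S.obj x) ?_ ?_ Γ' x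
  · intro Γ' σ x
    rw [ctxAppend_right, lift_fst_assoc, subst_proj]; rfl
  · intro Γ' σ x
    rw [ctxAppend_left, lift_snd_assoc, subst_proj]; rfl

theorem ctxAppend_cons (Γ : List Sg.Srt) (σ τ : Sg.Srt) (Γ' : List Sg.Srt) :
    (α_ (S.ctx Γ) (S.ctx (τ :: Γ')) (S.obj σ)).inv ≫
      (ctxAppend S.obj Γ (τ :: Γ') ▷ S.obj σ) ≫ S.ext (τ :: Γ' ++ Γ) σ =
      ctxAppend S.obj Γ (σ :: τ :: Γ') := by
  refine ctx_hom_ext S.obj _ _ _ (fun ρ x => ?_)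
  rw [Category.assoc, Category.assoc]
  cases x with
  | zero =>
    rw [ext_zero, whiskerRight_snd, associator_inv_snd]
    exact (ctxLift_proj S.obj (σ :: τ :: Γ' ++ Γ) (appendHom S.obj (σ :: τ :: Γ') (fst (S.ctx Γ) _)
      (fun _ x => snd (S.ctx Γ) (S.ctx (σ :: τ :: Γ')) ≫ ctxProj S.obj x)) .zero).symm
  | succ x =>
    rw [ext_succ, whiskerRight_fst_assoc]
    refine Eq.trans ?_ (ctxLift_proj S.obj _ _ _).symm
    rw [ctxAppend, ctxLift_proj]
    change _ = appendHom S.obj (τ :: Γ') _ _ ρ x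
    refine append_var Γ (P := fun Γ'' ρ x => ∀ (g : S.ctx Γ'' ⊗ S.obj σ ⟶ S.ctx Γ''),
      g = fst _ _ → (α_ (S.ctx Γ) (S.ctx Γ'') (S.obj σ)).inv ≫ fst _ _ ≫
      appendHom S.obj Γ'' (fst (S.ctx Γ) _) (fun _ x => snd _ (S.ctx Γ'') ≫ ctxProj S.obj x) ρ x =
      appendHom S.obj Γ'' (fst (S.ctx Γ) (S.ctx Γ'' ⊗ S.obj σ))
        (fun _ x => snd _ _ ≫ g ≫ ctxProj S.obj x) ρ x) ?_ ?_ (τ :: Γ') x _ rfl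
    · rintro Γ'' ρ x g rfl
      rw [ctxAppend_right, ctxAppend_right, associator_inv_fst_fst_assoc]
    · rintro Γ'' ρ x g rfl
      rw [ctxAppend_left, ctxAppend_left, associator_inv_fst_snd_assoc]

theorem ctxAppend_nil (Γ : List Sg.Srt) : ctxAppend S.obj Γ [] = fst _ _ := by
  refine ctx_hom_ext S.obj Γ _ _ (fun σ x => ?_)
  exact ctxLift_proj S.obj Γ _ x

theorem fml_quants (Ω : L.Quant) {Γ : List Sg.Srt} :
    (Γ' : List Sg.Srt) → (φ : Formula L Sg (Γ' ++ Γ)) → S.fml (.quants Ω Γ' φ) =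
    A.quant Ω (S.ctx Γ) (S.ctx Γ') (pb A.P (ctxAppend S.obj Γ Γ') (S.fml φ))
  | [], φ => by
    rw [ctxAppend_nil]; exact (A.quant_one Ω _ _).symm
  | [_], _ => rfl
  | σ :: τ :: Γ', φ => by
    rw [Formula.quants, fml_quants Ω (τ :: Γ')]
    change A.quant Ω (S.ctx Γ) (S.ctx (τ :: Γ')) (pb A.P (ctxAppend S.obj Γ (τ :: Γ'))
      (A.quant Ω (S.ctx (τ :: Γ' ++ Γ)) (S.obj σ)
        (pb A.P (S.ext (τ :: Γ' ++ Γ) σ) (S.fml φ)))) = _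
    rw [A.pb_quant, ← A.quant_prod, ← pb_comp, ← pb_comp, Category.assoc, ctxAppend_cons]
    rfl

theorem fml_eqs {Δ : List Sg.Srt} : (Γ : List Sg.Srt) → (γ δ : Subst Sg Δ Γ) →
    S.fml (.eqs Γ γ δ : Formula L Sg Δ) =
    pb A.P (CartesianMonoidalCategory.lift (S.subst γ) (S.subst δ)) (A.Eq (S.ctx Γ))
  | [], γ, δ => by
    rw [Formula.eqs, fml_e]
    change _ = pb A.P _ (A.Eq (𝟙_ A.C))
    rw [A.Eq_one]
    exact (A.pb_e _).symm
  | [_], _, _ => rfl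
  | σ :: τ :: Γ, γ, δ => by
    rw [Formula.eqs, fml_tensor, fml_eqs (τ :: Γ)]
    change _ = pb A.P (CartesianMonoidalCategory.lift
      (CartesianMonoidalCategory.lift (S.subst fun _ x => γ _ x.succ) (S.term (γ _ .zero)))
      (CartesianMonoidalCategory.lift (S.subst fun _ x => δ _ x.succ) (S.term (δ _ .zero))))
      (A.Eq (S.ctx (τ :: Γ) ⊗ S.obj σ))
    rw [A.Eq_prod]
    refine Eq.trans ?_ (A.pb_tensor _ _ _).symm
    rw [← pb_comp, ← pb_comp]
    simp only [comp_lift, lift_fst_assoc, lift_snd_assoc, lift_fst, lift_snd]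
    rfl

variable {T : Theory L Sg} (hT : T.IsLm) (hS : T ⊆ S.Th)

/-- The functor `S̄^o : C_T ⥤ C`, with `S̄^o(Γ) = ⟦Γ⟧` and
`S̄^o([M₁, …, Mₙ]) = ⟨⟦M₁⟧, …, ⟦Mₙ⟧⟩`. -/
def barFunctor : hT.Ctx ⥤ A.C where
  obj Γ := S.ctx Γ.list
  map {Δ Γ} := Quotient.lift (fun γ : Subst Sg Δ.list Γ.list => S.subst γ) (fun γ δ h => by
    have h' : ∀ σ x, S.term (γ σ x) = S.term (δ σ x) := fun σ x => hS (h σ x)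
    simp only [subst, h'])
  map_id Γ := S.subst_ids Γ.list
  map_comp := by
    rintro _ _ _ ⟨γ⟩ ⟨δ⟩
    exact S.subst_comp γ δ

theorem isIso_barFunctor (Γ Γ' : hT.Ctx) :
    IsIso (prodComparison (S.barFunctor hT hS) Γ Γ') :=
  ⟨ctxAppend S.obj Γ.list Γ'.list, S.lift_ctxAppend Γ.list Γ'.list, by
    refine (comp_lift _ _ _).trans ((congrArg₂ CartesianMonoidalCategory.lift
      (S.ctxAppend_fst Γ.list Γ'.list) (S.ctxAppend_snd Γ.list Γ'.list)).trans lift_fst_snd)⟩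

theorem preserves_barFunctor : Limits.PreservesFiniteProducts (S.barFunctor hT hS) := by
  have := S.isIso_barFunctor hT hS
  have := preservesLimitsOfShape_discrete_walkingPair_of_isIso_prodComparison
    (S.barFunctor hT hS)
  have : IsIso (terminalComparison (S.barFunctor hT hS)) :=
    ⟨𝟙 (𝟙_ A.C), toUnit_unique _ _, toUnit_unique _ _⟩
  have := preservesLimit_empty_of_isIso_terminalComparison (S.barFunctor hT hS)
  have := Limits.preservesLimitsOfShape_pempty_of_preservesTerminal (S.barFunctor hT hS)
  exact .of_preserves_binary_and_terminal _

/-- The maps `S̄^p : P_T(Γ) → P(⟦Γ⟧)`, with `S̄^p(φ [Γ]) = ⟦φ [Γ]⟧`. -/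
def barPred (Γ : List Sg.Srt) : hT.Fml Γ →o Pr A.P (S.ctx Γ) where
  toFun := Quotient.lift (fun φ : Formula L Sg Γ => S.fml φ) (fun _ _ h =>
    le_antisymm (S.seq_single.1 (hS h.1)) (S.seq_single.1 (hS h.2)))
  monotone' := by
    rintro ⟨φ⟩ ⟨ψ⟩ h
    exact S.seq_single.1 (hS h)

/-- The morphism `S̄ : (C_T, P_T) ⟶ (C, P)` of `FA` induced by a `T`-model `S`. -/
noncomputable def bar : FA.Hom hT.classifying A where
  o := S.barFunctor hT hS
  preserves := S.preserves_barFunctor hT hS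
  p Γ := S.barPred hT hS Γ.list
  natural := by
    rintro Δ Γ ⟨γ⟩ ⟨φ⟩
    exact S.fml_subst φ γ
  map_conn {n} o Γ x := by
    choose φ hφ using fun i => hT.cls_surjective (x i)
    obtain rfl : (fun i => hT.cls (φ i)) = x := funext hφ
    exact congrArg (S.barPred hT hS Γ.list) (hT.conn_cls o φ)
  map_quant Ω Γ Γ' x := by
    obtain ⟨φ, rfl⟩ := hT.cls_surjective x
    refine (S.fml_quants Ω Γ'.list φ).trans ?_
    have := S.isIso_barFunctor hT hS Γ Γ'
    have : inv (prodComparison (S.barFunctor hT hS) Γ Γ') = ctxAppend S.obj Γ.list Γ'.list :=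
      IsIso.inv_eq_of_hom_inv_id (S.lift_ctxAppend Γ.list Γ'.list)
    refine congrArg (A.quant Ω _ _) ?_
    exact congrArg (fun g => pb A.P g (S.fml φ)) this.symm
  map_Eq Γ := S.fml_eqs Γ.list _ _

end Structure

/-! ### The internal structure of a prop-category -/

namespace FA

variable {L : Language.{q, k}}

/-- The internal signature of `(C, P)`: its sorts are the objects of `C`, its function symbols
`c₁, …, cₙ → c` are the morphisms `c₁ × ⋯ × cₙ ⟶ c`, and its relation symbols on `c₁, …, cₙ` are the
elements of `P(c₁ × ⋯ × cₙ)`. -/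
def internalSig (A : FA.{q, k, u, v, w} L) : Signature.{u, v, w} where
  Srt := A.C
  Fn Γ c := ctxObj (fun c : A.C => c) Γ ⟶ c
  Rel Γ := Pr A.P (ctxObj (fun c : A.C => c) Γ)

/-- The internal structure of `(C, P)`: every symbol is interpreted by itself. -/
def internal (A : FA.{q, k, u, v, w} L) : Structure A.internalSig A where
  obj c := c
  fn h := h
  rel R := R

end FA

end FibLog

/-! The point is that `T` is the full theory of `S`, and that the internal signature names
everything in `(C, P)`. Because `T = Th(S)`, two lists of terms with the same interpretation are
provably equal, and an inequality between interpreted formulas is a sequent of `T`. So the functor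
`S̄^o` is faithful (`faithful_barFunctor`) and every map `S̄^p` reflects the order
(`barPred_le_iff`); both hold for any structure, taken with its own theory. Because every morphism
is a function symbol and every element of `P` is a relation symbol, `S̄^o` is full
(`full_barFunctor_internal`) and every `S̄^p` is onto (`barPred_internal_surjective`). Hence `S̄^o`
is fully faithful and each `S̄^p` is an isomorphism of posets. Finally `S̄^o` sends the one-variable
context `[c]` to `c` itself, so `c ↦ [c]` is a section on objects and `S̄^o` is an equivalence of
categories.

To obtain a 2-equivalence, the quasi-inverse must itself be a morphism of `FA`. This is not a formal
consequence of the above: no axiom makes `Ω_{b,c}` invariant under isomorphisms of `c`, or `Eq_c`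
invariant under isomorphisms of `c`. The criterion `Hom.isTwoEquivalence_of_section` therefore asks
that the isomorphisms `ε` from the image of the section to the objects of the target respect
quantifiers and equality. Here `ε` consists of identities, so the requirement is met trivially. -/

namespace FibLog

open CategoryTheory MonoidalCategory CartesianMonoidalCategory Opposite

universe q k s f r u v w u' v' w'

/-! ### Sections of fully faithful functors -/

section

variable {C : Type u} [Category.{v} C] {D : Type u'} [Category.{v'} D] {F : C ⥤ D}

/-- A fully faithful functor together with an objectwise section up to isomorphism yields a
functor in the opposite direction. -/
def sectionFunctor (hF : F.FullyFaithful) {s : D → C} (ε : ∀ d, F.obj (s d) ≅ d) : D ⥤ C where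
  obj := s
  map {b c} h := hF.preimage ((ε b).hom ≫ h ≫ (ε c).inv)
  map_id c := hF.map_injective (by simp)
  map_comp g h := hF.map_injective (by simp)

/-- Arrows were defined as preimages of conjugates by `ε` precisely so that `ε` becomes natural. The
later constructions need only this square, and so are stated for any functor `G` with such an `ε`.
-/
theorem sectionFunctor_naturality (hF : F.FullyFaithful) {s : D → C}
    (ε : ∀ d, F.obj (s d) ≅ d) {b c : D} (h : b ⟶ c) :
    F.map ((sectionFunctor hF ε).map h) ≫ (ε c).hom = (ε b).hom ≫ h := by
  change F.map (hF.preimage ((ε b).hom ≫ h ≫ (ε c).inv)) ≫ (ε c).hom = (ε b).hom ≫ h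
  simp

variable {G : D ⥤ C} (ε : ∀ d, F.obj (G.obj d) ≅ d)

/-- A right inverse up to natural isomorphism of a fully faithful functor is a left inverse up to
natural isomorphism. -/
def sectionUnit (hF : F.FullyFaithful)
    (hε : ∀ {b c : D} (h : b ⟶ c), F.map (G.map h) ≫ (ε c).hom = (ε b).hom ≫ h) :
    F ⋙ G ≅ 𝟭 C :=
  NatIso.ofComponents (fun c => hF.preimageIso (ε (F.obj c)))
    -- Faithfulness allows the naturality square to be checked after applying `F`, where the
    -- preimages disappear and the square is `hε` for the arrow `F.map h`.
    (fun h => hF.map_injective (by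
      simp only [Functor.comp_map, Functor.id_map, Functor.map_comp]
      exact (congrArg (F.map (G.map (F.map h)) ≫ ·) (hF.map_preimage _)).trans
        ((hε (F.map h)).trans (congrArg (· ≫ F.map h) (hF.map_preimage _).symm))))

/-- With `ε` on one side and `sectionUnit` on the other, `G` is an equivalence with quasi-inverse
`F`, and equivalences preserve all limits. Nothing about products in `F` is used. -/
theorem preservesFiniteProducts_of_section (hF : F.FullyFaithful)
    (hε : ∀ {b c : D} (h : b ⟶ c), F.map (G.map h) ≫ (ε c).hom = (ε b).hom ≫ h) :
    Limits.PreservesFiniteProducts G :=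
  have : G.IsEquivalence :=
    (CategoryTheory.Equivalence.mk G F (NatIso.ofComponents (F := G ⋙ F) (G := 𝟭 D) ε hε).symm
      (sectionUnit ε hF hε)).isEquivalence_functor
  inferInstance

/-- Both sides have the same two projections, by naturality of `ε` along `fst` and `snd`. The
identity trades the comparison maps of `F` and `G`, which occur in the quantifier and equality
clauses of a morphism of `FA`, for the product of two components of `ε`. -/
theorem map_prodComparison_section [CartesianMonoidalCategory C] [CartesianMonoidalCategory D]
    (hε : ∀ {b c : D} (h : b ⟶ c), F.map (G.map h) ≫ (ε c).hom = (ε b).hom ≫ h) (b c : D) :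
    F.map (prodComparison G b c) ≫ prodComparison F (G.obj b) (G.obj c) ≫
      ((ε b).hom ⊗ₘ (ε c).hom) = (ε (b ⊗ c)).hom := by
  apply CartesianMonoidalCategory.hom_ext
  · rw [Category.assoc, Category.assoc, tensorHom_fst, prodComparison_fst_assoc,
      ← F.map_comp_assoc, prodComparison_fst, hε]
  · rw [Category.assoc, Category.assoc, tensorHom_snd, prodComparison_snd_assoc,
      ← F.map_comp_assoc, prodComparison_snd, hε]

end

/-! ### A criterion for 2-equivalences in `FA` -/

namespace FA

variable {L : Language.{q, k}} {A : FA.{q, k, u, v, w} L} {B : FA.{q, k, u', v', w'} L}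
  (F : Hom A B) (hF : F.o.FullyFaithful)
  (e : ∀ c, Pr A.P c ≃o Pr B.P (F.o.obj c)) (he : ∀ c x, e c x = F.p c x)
  {G : B.C ⥤ A.C} (ε : ∀ c, F.o.obj (G.obj c) ≅ c)
  (hε : ∀ {b c : B.C} (h : b ⟶ c), F.o.map (G.map h) ≫ (ε c).hom = (ε b).hom ≫ h)
  (hquant : ∀ (Ω : L.Quant) (b c : B.C) (x : Pr B.P (b ⊗ c)),
    B.quant Ω _ _ (pb B.P ((ε b).hom ⊗ₘ (ε c).hom) x) = pb B.P (ε b).hom (B.quant Ω b c x))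
  (hEq : ∀ c : B.C, pb B.P ((ε c).hom ⊗ₘ (ε c).hom) (B.Eq c) = B.Eq (F.o.obj (G.obj c)))

/-- The predicate component of the pseudo-inverse. -/
def sectionPred (c : B.C) : Pr B.P c →o Pr A.P (G.obj c) where
  toFun x := (e (G.obj c)).symm (pb B.P (ε c).hom x)
  monotone' _ _ h := (e (G.obj c)).symm.monotone (pb_mono B.P _ h)

include he in
-- The inverse of `e` cancels against `F.p`. Besides characterizing `sectionPred`, this equation is
-- exactly the condition for `ε` to be a 2-cell from the composite on `B` to the identity.
theorem p_sectionPred (c : B.C) (x : Pr B.P c) :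
    F.p (G.obj c) (sectionPred F e ε c x) = pb B.P (ε c).hom x := by
  rw [← he]; exact (e (G.obj c)).apply_symm_apply _

include he in
-- The device behind all verifications below: an equation between predicates of `A` may be checked
-- in `B`, where `p_sectionPred` turns `sectionPred` into pullback along `ε`.
theorem p_injective (c : A.C) : Function.Injective (F.p c) := fun x y h =>
  (e c).injective (by rw [he, he, h])

/-- The pseudo-inverse of a morphism that is fully faithful, bijective on predicates, and has a
section compatible with quantifiers and equality. -/
def sectionHom : Hom B A where
  o := G
  preserves := preservesFiniteProducts_of_section ε hF hε
  p := sectionPred F e ε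
  natural {b c} h x := by
    apply p_injective F e he
    rw [F.natural, p_sectionPred F e he, p_sectionPred F e he, ← pb_comp, ← pb_comp, hε]
  map_conn i c x := by
    apply p_injective F e he
    simp only [F.map_conn, p_sectionPred F e he, B.pb_conn]
  map_quant Ω b c x := by
    -- Makes the comparison map of `G` invertible, as the cancellations below require.
    have := preservesFiniteProducts_of_section ε hF hε
    apply p_injective F e he
    -- In `B` both sides become `B.quant` of a pullback of `x`: on the left along the product of `ε
    -- b` and `ε c`, thanks to `hquant`, and on the right along `ε (b ⊗ c)` preceded by the inverses
    -- of the two comparison maps. Factoring `ε (b ⊗ c)` through those comparison maps makes the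
    -- inverses cancel.
    rw [F.map_quant, p_sectionPred F e he, F.natural, p_sectionPred F e he, ← hquant, ← pb_comp,
      ← pb_comp, ← map_prodComparison_section ε hε b c, Functor.map_inv,
      Category.assoc, IsIso.inv_hom_id_assoc, IsIso.inv_hom_id_assoc]
  map_Eq c := by
    apply p_injective F e he
    -- The same comparison as for quantifiers, but without inverses: `hEq` supplies the factor built
    -- from `ε c`, and the resulting composite is `ε (c ⊗ c)`.
    rw [p_sectionPred F e he, F.natural, F.map_Eq, ← hEq c, ← pb_comp, ← pb_comp,
      Category.assoc, map_prodComparison_section ε hε c c]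

include hF he hε hquant hEq in
-- The pseudo-inverse is `sectionHom`, and the two 2-isomorphisms are `sectionUnit` and `ε`.
-- Naturality of the quantifiers covers only the parameter object, not the object quantified over,
-- and equality predicates carry no naturality at all; `hquant` and `hEq` make up for this along
-- `ε`.
theorem Hom.isTwoEquivalence_of_section : F.IsTwoEquivalence := by
  refine ⟨sectionHom F hF e he ε hε hquant hEq, ⟨⟨(sectionUnit ε hF hε).hom, fun c x => ?_⟩,
    (sectionUnit ε hF hε).isIso_hom⟩, ⟨⟨(NatIso.ofComponents (F := G ⋙ F.o) (G := 𝟭 B.C) ε hε).hom,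
      fun c x => p_sectionPred F e he ε c x⟩,
      (NatIso.ofComponents (F := G ⋙ F.o) (G := 𝟭 B.C) ε hε).isIso_hom⟩⟩
  -- The 2-cell condition for `sectionUnit`. After applying `F.p`, both sides are pullbacks of `F.p
  -- c x`, one along `ε` at `F.o.obj c` and one along the image of the component of `sectionUnit`;
  -- these agree because that component is a preimage of `ε`.
  apply p_injective F e he
  refine (p_sectionPred F e he ε _ _).trans (Eq.trans ?_ (F.natural _ _).symm)
  exact congrArg (fun h => pb B.P h (F.p c x)) (hF.map_preimage _).symm

end FA

/-! ### A structure and its own theory: faithfulness and order reflection -/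

namespace Structure

variable {L : Language.{q, k}} {Sg : Signature.{s, f, r}} {A : FA.{q, k, u, v, w} L}
  (S : Structure Sg A)

/-- Equality in the classifying category is provable equality, and for the theory of `S` this means
equality of interpretations. Equal tuples have equal components, so all the required equations lie
in `S.Th`. -/
theorem faithful_barFunctor : (S.barFunctor S.th_isLm subset_rfl).Faithful where
  map_injective {Δ Γ} g h H := by
    obtain ⟨γ, rfl⟩ := S.th_isLm.hom_surjective g
    obtain ⟨δ, rfl⟩ := S.th_isLm.hom_surjective h
    refine S.th_isLm.hom_eq fun σ x => ?_
    change S.subst γ = S.subst δ at H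
    change S.term _ = S.term _
    rw [← S.subst_proj, H, S.subst_proj]

/-- On representatives, the order of `P_T` is membership of a one-premise sequent in `S.Th`, which
is by definition truth of the inequality in `S`, the product of a single premise being that premise.
-/
theorem barPred_le_iff (Γ : List Sg.Srt) {x y : S.th_isLm.Fml Γ} :
    S.barPred S.th_isLm subset_rfl Γ x ≤ S.barPred S.th_isLm subset_rfl Γ y ↔ x ≤ y := by
  obtain ⟨φ, rfl⟩ := S.th_isLm.cls_surjective x
  obtain ⟨ψ, rfl⟩ := S.th_isLm.cls_surjective y
  exact S.seq_single.symm

end Structure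

/-! ### The internal structure: fullness and surjectivity on predicates -/

namespace FA

variable {L : Language.{q, k}} (A : FA.{q, k, u, v, w} L)

/-- A morphism into `⟦Γ⟧` is determined by its components, and each component, a morphism from `⟦Δ⟧`
to a sort, is a function symbol of the internal signature. Applying these symbols to the variables
of `Δ` gives the required list of terms. -/
theorem full_barFunctor_internal :
    (A.internal.barFunctor A.internal.th_isLm subset_rfl).Full where
  map_surjective {Δ Γ} g := by
    refine ⟨A.internal.th_isLm.hom fun σ x =>
      .app (Δ := Δ.list) (show A.internalSig.Fn Δ.list σ from g ≫ ctxProj _ x) (Subst.ids Δ.list), ?_⟩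
    refine ctx_hom_ext _ Γ.list _ _ fun σ x => ?_
    refine (A.internal.subst_proj _ x).trans ?_
    change A.internal.subst (.ids Δ.list) ≫ g ≫ ctxProj _ x = _
    rw [A.internal.subst_ids, Category.id_comp]
    rfl

/-- An element of `P(⟦Γ⟧)` is a relation symbol on `Γ`; applied to the variables of `Γ`, it is
interpreted as its own pullback along the identity. -/
theorem barPred_internal_surjective (Γ : List A.internalSig.Srt) :
    Function.Surjective (A.internal.barPred A.internal.th_isLm subset_rfl Γ) := fun x =>
  ⟨A.internal.th_isLm.cls (.rel (Δ := Γ) (show A.internalSig.Rel Γ from x) (.ids Γ)), by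
    change pb A.P (A.internal.subst (.ids Γ)) x = x
    rw [A.internal.subst_ids, pb_id]⟩

end FA

end FibLog

/-! ### The 2-equivalence -/

theorem mainTheorem9 {L : FibLog.Language} (A : FibLog.FA L) :
    (A.internal.bar A.internal.th_isLm (Set.Subset.refl A.internal.Th)).IsTwoEquivalence := by
  have := A.internal.faithful_barFunctor
  have := A.full_barFunctor_internal
  -- The convention that a product of one factor is that factor makes `⟦[c]⟧` equal to `c` by
  -- definition, so the section is strict on objects and `ε` can be the identity.
  let ε (c : A.C) : (A.internal.barFunctor A.internal.th_isLm subset_rfl).obj ⟨[c]⟩ ≅ c :=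
    CategoryTheory.Iso.refl c
  have hF := CategoryTheory.Functor.FullyFaithful.ofFullyFaithful
    (A.internal.barFunctor A.internal.th_isLm subset_rfl)
  refine FibLog.FA.Hom.isTwoEquivalence_of_section _
    hF
    (fun Γ => RelIso.ofSurjective
      (OrderEmbedding.ofMapLEIff (A.internal.barPred A.internal.th_isLm subset_rfl Γ.list)
        fun _ _ => A.internal.barPred_le_iff Γ.list)
      (A.barPred_internal_surjective Γ.list))
    (fun _ _ => rfl)
    (G := FibLog.sectionFunctor hF ε) ε
    (FibLog.sectionFunctor_naturality hF ε) ?_ ?_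
  -- Compatibility of `ε` with quantifiers. Since `ε` is the identity, both pullbacks are along
  -- identities, the inner one because a product of identities is an identity. Equality is handled
  -- in the same way below.
  · intro Ω b c x
    refine Eq.trans ?_ (FibLog.pb_id A.P _).symm
    refine congrArg (A.quant Ω b c) (Eq.trans ?_ (FibLog.pb_id A.P x))
    exact congrArg (fun h => FibLog.pb A.P h x) (CategoryTheory.MonoidalCategory.id_tensorHom_id b c)
  · intro c
    refine Eq.trans ?_ (FibLog.pb_id A.P (A.Eq c))
    exact congrArg (fun h => FibLog.pb A.P h (A.Eq c))
      (CategoryTheory.MonoidalCategory.id_tensorHom_id c c)
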